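/- Let $G$ be a compact (Hausdorff) group, and let $\widehat G$ be its dual object, i.e. the set of unitary equivalence classes of continuous irreducible unitary representations $\pi$ of $G$, with a representative on a Hilbert space $\mathcal H_\pi$ of finite dimension $d_\pi$ fixed in each class. A weight is a function $\omega:\widehat G\to(0,\infty)$ with $\omega(\sigma)\le\omega(\pi)\omega(\pi')$ whenever $\sigma$ is unitarily equivalent to a subrepresentation of $\pi\otimes\pi'$; it is not assumed that $\inf_{\pi}\omega(\pi)>0$. Let $\mathrm{Trig}_\pi(G)\subset C(G)$ be the linear span of the matrix coefficients of $\pi$. For $u=(u_\pi)_\pi\in\prod_{\pi\in\widehat G}\mathrm{Trig}_\pi(G)$ put $\hat u(\pi)=\int_G u_\pi(s)\,\pi(s^{-1})\,ds$, with respect to normalized Haar measure, and define \[ A_\omega(G)=\Bigl\{u\in\prod_{\pi\in\widehat G}\mathrm{Trig}_\pi(G):\ \|u\|_\omega=\sum_{\pi\in\widehat G}\|\hat u(\pi)\|_1\,d_\pi\,\omega(\pi)<\infty\Bigr\}, \] where $\|\cdot\|_1$ is the trace norm. Identify the space $\mathrm{Trig}(G)=\bigoplus_\pi\mathrm{Trig}_\pi(G)$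 of trigonometric polynomials with the subspace of finitely supported elements of $A_\omega(G)$. Theorem. For every weight $\omega$ on $\widehat G$, the space $(A_\omega(G),\|\cdot\|_\omega)$ is complete, there is exactly one bilinear product on it that extends pointwise multiplication on $\mathrm{Trig}(G)$ and makes it a unital commutative Banach algebra (with unit the constant function $1$ and $\|uv\|_\omega\le\|u\|_\omega\|v\|_\omega$), and with this product the Beurling--Fourier algebra $A_\omega(G)$ is semisimple, i.e. its Jacobson radical is $\{0\}$. -/

import Mathlib

open MeasureTheory
open scoped Matrix Kronecker ComplexConjugate InnerProductSpace

noncomputable section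

/-! ## The dual object of a compact group -/

/-- The representation of `G` on `ℂⁿ` given by a homomorphism into the unitary matrices. -/
def unitaryRep {G : Type*} [Group G] {n : ℕ} (ρ : G →* Matrix.unitaryGroup (Fin n) ℂ) :
    Representation ℂ G (Fin n → ℂ) :=
  ((Matrix.toLinAlgEquiv' : Matrix (Fin n) (Fin n) ℂ ≃ₐ[ℂ] _).toAlgHom.toMonoidHom.comp
    (Matrix.unitaryGroup (Fin n) ℂ).subtype).comp ρ

/-- A continuous irreducible unitary representation of `G` on the Hilbert space `ℂⁿ`.  (All
irreducible unitary representations of a compact group are finite-dimensional.) -/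
structure UnitaryIrrep (G : Type*) [Group G] [TopologicalSpace G] where
  dim : ℕ
  hom : G →* Matrix.unitaryGroup (Fin dim) ℂ
  continuous_hom : Continuous hom
  irreducible : (unitaryRep hom).IsIrreducible

namespace UnitaryIrrep

variable {G : Type*} [Group G] [TopologicalSpace G]

/-- The unitary matrix `π(s)`. -/
def mat (π : UnitaryIrrep G) (s : G) : Matrix (Fin π.dim) (Fin π.dim) ℂ := (π.hom s).1

lemma continuous_mat (π : UnitaryIrrep G) : Continuous π.mat :=
  continuous_subtype_val.comp π.continuous_hom

lemma mat_inv_apply (π : UnitaryIrrep G) (s : G) (i j : Fin π.dim) :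
    π.mat s⁻¹ i j = conj (π.mat s j i) := by
  have : π.hom s⁻¹ = star (π.hom s) := by rw [map_inv]; rfl
  simp [UnitaryIrrep.mat, this, Matrix.star_apply]

lemma dim_pos (π : UnitaryIrrep G) : 0 < π.dim := by
  rcases Nat.eq_zero_or_pos π.dim with h | h
  · exfalso
    have := π.irreducible
    obtain ⟨a, b, hab⟩ := (this.toNontrivial : Nontrivial (Subrepresentation _))
    apply hab
    have : Subsingleton (Fin π.dim → ℂ) := by rw [h]; infer_instance
    apply Subrepresentation.toSubmodule_injective
    exact Subsingleton.elim _ _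
  · exact h

/-- Unitary equivalence: `V` is a unitary intertwiner from `σ` to `π`. -/
def Equivalent (σ π : UnitaryIrrep G) : Prop :=
  ∃ V : Matrix (Fin π.dim) (Fin σ.dim) ℂ, Vᴴ * V = 1 ∧ V * Vᴴ = 1 ∧
    ∀ s, π.mat s * V = V * σ.mat s

lemma Equivalent.refl (π : UnitaryIrrep G) : Equivalent π π := ⟨1, by simp⟩

lemma Equivalent.symm {σ π : UnitaryIrrep G} (h : Equivalent σ π) : Equivalent π σ := by
  obtain ⟨V, h1, h2, h3⟩ := h
  refine ⟨Vᴴ, by simpa using h2, by simpa using h1, fun s => ?_⟩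
  calc σ.mat s * Vᴴ = (Vᴴ * V) * σ.mat s * Vᴴ := by rw [h1, one_mul]
    _ = Vᴴ * (V * σ.mat s) * Vᴴ := by simp only [Matrix.mul_assoc]
    _ = Vᴴ * π.mat s * (V * Vᴴ) := by rw [← h3]; simp only [Matrix.mul_assoc]
    _ = Vᴴ * π.mat s := by rw [h2, Matrix.mul_one]

lemma Equivalent.trans {σ π τ : UnitaryIrrep G} (h : Equivalent σ π) (h' : Equivalent π τ) :
    Equivalent σ τ := by
  obtain ⟨V, h1, h2, h3⟩ := h
  obtain ⟨W, k1, k2, k3⟩ := h'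
  refine ⟨W * V, ?_, ?_, fun s => ?_⟩
  · calc (W * V)ᴴ * (W * V) = Vᴴ * (Wᴴ * W) * V := by
          simp only [Matrix.conjTranspose_mul, Matrix.mul_assoc]
      _ = 1 := by rw [k1, Matrix.mul_one, h1]
  · calc (W * V) * (W * V)ᴴ = W * (V * Vᴴ) * Wᴴ := by
          simp only [Matrix.conjTranspose_mul, Matrix.mul_assoc]
      _ = 1 := by rw [h2, Matrix.mul_one, k2]
  · rw [← Matrix.mul_assoc, k3, Matrix.mul_assoc, h3, Matrix.mul_assoc]

/-- `σ ⊂ π ⊗ π'`: there is an isometric intertwiner of `σ` into `π ⊗ π'`, i.e. `σ` is unitarily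
equivalent to a subrepresentation of `π ⊗ π'`. -/
def IsSubrepOfTensor (σ π π' : UnitaryIrrep G) : Prop :=
  ∃ V : Matrix (Fin π.dim × Fin π'.dim) (Fin σ.dim) ℂ, Vᴴ * V = 1 ∧
    ∀ s, (π.mat s ⊗ₖ π'.mat s) * V = V * σ.mat s

instance setoid (G : Type*) [Group G] [TopologicalSpace G] : Setoid (UnitaryIrrep G) where
  r := Equivalent
  iseqv := ⟨Equivalent.refl, Equivalent.symm, Equivalent.trans⟩

end UnitaryIrrep

/-- The dual object `Ĝ`: unitary equivalence classes of continuous irreducible unitary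
representations. -/
def DualObject (G : Type*) [Group G] [TopologicalSpace G] : Type _ :=
  Quotient (UnitaryIrrep.setoid G)

/-- A fixed representative of a class in `Ĝ`. -/
def DualObject.rep {G : Type*} [Group G] [TopologicalSpace G] (π : DualObject G) :
    UnitaryIrrep G :=
  Quotient.out π

/-- A weight on `Ĝ`. -/
structure DualWeight (G : Type*) [Group G] [TopologicalSpace G] where
  toFun : DualObject G → ℝ
  pos : ∀ π, 0 < toFun π
  le_mul : ∀ σ π π' : DualObject G, σ.rep.IsSubrepOfTensor π.rep π'.rep →
    toFun σ ≤ toFun π * toFun π'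

/-! ## The trace norm -/

/-- The trace norm `‖A‖₁ = Tr |A|`: the sum of the singular values of the operator `A` on the
Hilbert space `ℂⁿ`. -/
def traceNorm {n : ℕ} (A : Matrix (Fin n) (Fin n) ℂ) : ℝ :=
  ∑ i : Fin n, (Matrix.toEuclideanLin A).singularValues i

section TraceNorm

variable {n : ℕ}

lemma traceNorm_nonneg (A : Matrix (Fin n) (Fin n) ℂ) : 0 ≤ traceNorm A :=
  Finset.sum_nonneg fun _ _ => LinearMap.singularValues_nonneg _ _

lemma traceNorm_zero : traceNorm (0 : Matrix (Fin n) (Fin n) ℂ) = 0 := by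
  simp [traceNorm]

lemma eq_zero_of_traceNorm_eq_zero {A : Matrix (Fin n) (Fin n) ℂ} (h : traceNorm A = 0) :
    A = 0 := by
  have h0 : (Matrix.toEuclideanLin A).singularValues = 0 := by
    ext i
    by_cases hi : i < n
    · exact (Finset.sum_eq_zero_iff_of_nonneg
        (fun _ _ => LinearMap.singularValues_nonneg _ _)).1 h ⟨i, hi⟩ (Finset.mem_univ _)
    · exact LinearMap.singularValues_of_finrank_le _ (by simpa using hi)
  rw [LinearMap.singularValues_eq_zero_iff] at h0
  simpa using h0

/-- There is an orthonormal basis whose images under `A` are orthogonal and have the singular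
values as norms. -/
lemma exists_singular_basis (A : Matrix (Fin n) (Fin n) ℂ) :
    ∃ b : OrthonormalBasis (Fin n) ℂ (EuclideanSpace ℂ (Fin n)),
      (∀ i, ‖Matrix.toEuclideanLin A (b i)‖ = (Matrix.toEuclideanLin A).singularValues i) ∧
      (∀ i j, i ≠ j →
        ⟪Matrix.toEuclideanLin A (b i), Matrix.toEuclideanLin A (b j)⟫_ℂ = 0) := by
  set T := Matrix.toEuclideanLin A
  have hn : Module.finrank ℂ (EuclideanSpace ℂ (Fin n)) = n := by simp
  set b := T.isSymmetric_adjoint_comp_self.eigenvectorBasis hn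
  have key : ∀ i j, ⟪T (b i), T (b j)⟫_ℂ =
      (T.isSymmetric_adjoint_comp_self.eigenvalues hn j : ℂ) * ⟪b i, b j⟫_ℂ := by
    intro i j
    rw [← LinearMap.adjoint_inner_right]
    have := T.isSymmetric_adjoint_comp_self.apply_eigenvectorBasis hn j
    rw [LinearMap.comp_apply] at this
    rw [this, inner_smul_right]
    rfl
  refine ⟨b, fun i => ?_, fun i j hij => ?_⟩
  · have h1 := key i i
    rw [inner_self_eq_norm_sq_to_K, inner_self_eq_norm_sq_to_K, b.orthonormal.1 i] at h1
    have h2 : ‖T (b i)‖ ^ 2 = T.isSymmetric_adjoint_comp_self.eigenvalues hn i := by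
      rw [RCLike.ofReal_one, one_pow, mul_one] at h1
      exact Complex.ofReal_injective (by push_cast; exact h1)
    rw [T.singularValues_fin hn, ← h2, Real.sqrt_sq (norm_nonneg _)]
  · rw [key, b.orthonormal.2 hij, mul_zero]

/-- Half of the duality between the trace norm and the operator norm. -/
lemma sum_norm_inner_le_traceNorm (A : Matrix (Fin n) (Fin n) ℂ)
    (v : OrthonormalBasis (Fin n) ℂ (EuclideanSpace ℂ (Fin n)))
    (w : Fin n → EuclideanSpace ℂ (Fin n))
    (hw : ∀ x, ∑ i, ‖⟪w i, x⟫_ℂ‖ ^ 2 ≤ ‖x‖ ^ 2) :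
    ∑ i, ‖⟪w i, Matrix.toEuclideanLin A (v i)⟫_ℂ‖ ≤ traceNorm A := by
  obtain ⟨b, hb, -⟩ := exists_singular_basis A
  set T := Matrix.toEuclideanLin A
  have hexp : ∀ i, ⟪w i, T (v i)⟫_ℂ = ∑ k, ⟪b k, v i⟫_ℂ * ⟪w i, T (b k)⟫_ℂ := by
    intro i
    conv_lhs => rw [← b.sum_repr' (v i)]
    simp
  calc ∑ i, ‖⟪w i, T (v i)⟫_ℂ‖
      ≤ ∑ i, ∑ k, ‖⟪b k, v i⟫_ℂ‖ * ‖⟪w i, T (b k)⟫_ℂ‖ := by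
        refine Finset.sum_le_sum fun i _ => ?_
        rw [hexp]
        exact (norm_sum_le _ _).trans (by simp)
    _ = ∑ k, ∑ i, ‖⟪b k, v i⟫_ℂ‖ * ‖⟪w i, T (b k)⟫_ℂ‖ := Finset.sum_comm
    _ ≤ ∑ k : Fin n, T.singularValues k := by
        refine Finset.sum_le_sum fun k _ => ?_
        have h1 := Finset.sum_mul_sq_le_sq_mul_sq Finset.univ
          (fun i => ‖⟪b k, v i⟫_ℂ‖) (fun i => ‖⟪w i, T (b k)⟫_ℂ‖)
        have h2 : ∑ i, ‖⟪b k, v i⟫_ℂ‖ ^ 2 = 1 := by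
          rw [v.sum_sq_norm_inner_left, b.orthonormal.1 k, one_pow]
        have h3 := hw (T (b k))
        rw [h2, one_mul] at h1
        rw [← hb k]
        exact le_of_sq_le_sq (h1.trans h3) (norm_nonneg _)

lemma exists_traceNorm_eq (A : Matrix (Fin n) (Fin n) ℂ) :
    ∃ (v : OrthonormalBasis (Fin n) ℂ (EuclideanSpace ℂ (Fin n)))
      (w : Fin n → EuclideanSpace ℂ (Fin n)),
      (∀ x, ∑ i, ‖⟪w i, x⟫_ℂ‖ ^ 2 ≤ ‖x‖ ^ 2) ∧
      traceNorm A = ∑ i, ‖⟪w i, Matrix.toEuclideanLin A (v i)⟫_ℂ‖ := by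
  obtain ⟨b, hb, horth⟩ := exists_singular_basis A
  set T := Matrix.toEuclideanLin A
  set w : Fin n → EuclideanSpace ℂ (Fin n) := fun i => ((‖T (b i)‖⁻¹ : ℝ) : ℂ) • T (b i) with hwdef
  refine ⟨b, w, fun x => ?_, ?_⟩
  · set s : Set (Fin n) := {i | T (b i) ≠ 0} with hs
    have hon : Orthonormal ℂ (fun i : s => w i) := by
      refine ⟨fun i => ?_, fun i j hij => ?_⟩
      · have : ‖T (b i)‖ ≠ 0 := norm_ne_zero_iff.2 i.2
        simp [hwdef, norm_smul, this]
      · have : (i : Fin n) ≠ j := fun h => hij (Subtype.ext h)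
        simp [hwdef, inner_smul_left, inner_smul_right, horth _ _ this]
    classical
    have h1 := hon.sum_inner_products_le (x := x) (s := Finset.univ)
    refine le_trans (le_of_eq ?_) h1
    rw [← Finset.sum_subtype (Finset.univ.filter (· ∈ s)) (by simp)
      (fun i => ‖⟪w i, x⟫_ℂ‖ ^ 2)]
    refine (Finset.sum_filter_of_ne fun i _ hi => ?_).symm
    intro h
    apply hi
    simp [hwdef, h]
  · refine Finset.sum_congr rfl fun i _ => ?_
    rw [← hb i]
    by_cases h : T (b i) = 0
    · simp [h]
    · have : ‖T (b i)‖ ≠ 0 := norm_ne_zero_iff.2 h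
      simp only [hwdef, inner_smul_left, inner_self_eq_norm_sq_to_K]
      simp
      field_simp

lemma traceNorm_add_le (A B : Matrix (Fin n) (Fin n) ℂ) :
    traceNorm (A + B) ≤ traceNorm A + traceNorm B := by
  obtain ⟨v, w, hw, h⟩ := exists_traceNorm_eq (A + B)
  rw [h]
  refine le_trans ?_ (add_le_add (sum_norm_inner_le_traceNorm A v w hw)
    (sum_norm_inner_le_traceNorm B v w hw))
  rw [← Finset.sum_add_distrib]
  refine Finset.sum_le_sum fun i _ => ?_
  rw [map_add, LinearMap.add_apply, inner_add_right]
  exact norm_add_le _ _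

lemma traceNorm_smul_le (c : ℂ) (A : Matrix (Fin n) (Fin n) ℂ) :
    traceNorm (c • A) ≤ ‖c‖ * traceNorm A := by
  obtain ⟨v, w, hw, h⟩ := exists_traceNorm_eq (c • A)
  rw [h]
  refine le_trans (le_of_eq ?_) (mul_le_mul_of_nonneg_left
    (sum_norm_inner_le_traceNorm A v w hw) (norm_nonneg c))
  rw [Finset.mul_sum]
  refine Finset.sum_congr rfl fun i _ => ?_
  rw [map_smul, LinearMap.smul_apply, inner_smul_right, norm_mul]

lemma traceNorm_smul (c : ℂ) (A : Matrix (Fin n) (Fin n) ℂ) :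
    traceNorm (c • A) = ‖c‖ * traceNorm A := by
  refine le_antisymm (traceNorm_smul_le c A) ?_
  by_cases hc : c = 0
  · simp [hc, traceNorm_zero]
  · have h := traceNorm_smul_le c⁻¹ (c • A)
    rw [smul_smul, inv_mul_cancel₀ hc, one_smul, norm_inv] at h
    have : 0 < ‖c‖ := norm_pos_iff.2 hc
    rwa [← div_eq_inv_mul, le_div_iff₀' this] at h

end TraceNorm

/-! ## Trigonometric polynomials and Fourier coefficients -/

section Fourier

variable {G : Type*} [Group G] [TopologicalSpace G]

/-- The matrix coefficient `s ↦ π(s)ᵢⱼ`. -/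
def matrixCoeff (π : UnitaryIrrep G) (i j : Fin π.dim) : C(G, ℂ) where
  toFun s := π.mat s i j
  continuous_toFun := (continuous_apply j).comp ((continuous_apply i).comp π.continuous_mat)

lemma matrixCoeff_apply (π : UnitaryIrrep G) (i j : Fin π.dim) (s : G) :
    matrixCoeff π i j s = π.mat s i j := rfl

/-- `Trig_π(G)`: the span of the matrix coefficients of `π`. -/
def trigSpace (π : DualObject G) : Submodule ℂ C(G, ℂ) :=
  Submodule.span ℂ (Set.range fun p : Fin π.rep.dim × Fin π.rep.dim =>
    matrixCoeff π.rep p.1 p.2)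

variable [IsTopologicalGroup G] [CompactSpace G] [MeasurableSpace G] [BorelSpace G]

/-- The Haar measure of the compact group `G`, normalized to be a probability measure. -/
def haarProb (G : Type*) [Group G] [TopologicalSpace G] [IsTopologicalGroup G] [CompactSpace G]
    [MeasurableSpace G] [BorelSpace G] : Measure G :=
  Measure.haarMeasure ⊤

/-- The Fourier coefficient `û(π) = ∫ u(s) π(s⁻¹) ds`. -/
def fourierIntegral (π : DualObject G) (u : C(G, ℂ)) :
    Matrix (Fin π.rep.dim) (Fin π.rep.dim) ℂ :=
  Matrix.of fun i j => ∫ s, u s * π.rep.mat s⁻¹ i j ∂haarProb G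

instance : IsProbabilityMeasure (haarProb G) :=
  ⟨by simpa [haarProb] using
    (Measure.haarMeasure_self (K₀ := (⊤ : TopologicalSpace.PositiveCompacts G)))⟩

instance : (haarProb G).IsHaarMeasure := by unfold haarProb; infer_instance

lemma fourierIntegral_integrable (π : DualObject G) (u : C(G, ℂ)) (i j : Fin π.rep.dim) :
    Integrable (fun s => u s * π.rep.mat s⁻¹ i j) (haarProb G) := by
  have hc : Continuous fun s => u s * π.rep.mat s⁻¹ i j :=
    u.continuous.mul (((matrixCoeff π.rep i j).continuous).comp continuous_inv)
  exact hc.integrable_of_hasCompactSupport (HasCompactSupport.of_compactSpace _)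

/-- `u ↦ û(π)` is linear. -/
def fourierOp (π : DualObject G) :
    C(G, ℂ) →ₗ[ℂ] Matrix (Fin π.rep.dim) (Fin π.rep.dim) ℂ where
  toFun := fourierIntegral π
  map_add' u v := by
    ext i j
    simp only [fourierIntegral, Matrix.of_apply, Matrix.add_apply, ContinuousMap.add_apply, add_mul]
    exact integral_add (fourierIntegral_integrable π u i j) (fourierIntegral_integrable π v i j)
  map_smul' c u := by
    ext i j
    simp only [fourierIntegral, Matrix.of_apply, Matrix.smul_apply, ContinuousMap.smul_apply,
      smul_eq_mul, mul_assoc, RingHom.id_apply]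
    exact integral_const_mul _ _

/-- An element of `Trig_π(G)` is determined by its Fourier coefficient at `π`. -/
lemma eq_zero_of_fourierOp_eq_zero {π : DualObject G} {u : C(G, ℂ)} (hu : u ∈ trigSpace π)
    (h : fourierOp π u = 0) : u = 0 := by
  have hint : ∀ f g : C(G, ℂ), Integrable (fun s => f s * conj (g s)) (haarProb G) := fun f g =>
    (f.continuous.mul (Complex.continuous_conj.comp g.continuous)).integrable_of_hasCompactSupport
      (HasCompactSupport.of_compactSpace _)
  have key : ∀ v ∈ trigSpace π, ∫ s, u s * conj (v s) ∂haarProb G = 0 := by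
    intro v hv
    induction hv using Submodule.span_induction with
    | mem x hx =>
      obtain ⟨⟨i, j⟩, rfl⟩ := hx
      have := congrFun (congrFun h j) i
      simpa [fourierOp, fourierIntegral, UnitaryIrrep.mat_inv_apply, matrixCoeff_apply] using this
    | zero => simp
    | add x y _ _ hx hy =>
      simp only [ContinuousMap.add_apply, map_add, mul_add]
      rw [integral_add (hint u x) (hint u y), hx, hy, add_zero]
    | smul c x _ hx =>
      have : ∀ s, u s * conj ((c • x) s) = conj c * (u s * conj (x s)) := fun s => by
        simp; ring
      simp_rw [this]
      rw [integral_const_mul, hx, mul_zero]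
  have h0 := key u hu
  have h1 : ∫ s, ‖u s‖ ^ 2 ∂haarProb G = 0 := by
    have h2 : ∀ s, u s * conj (u s) = ((‖u s‖ ^ 2 : ℝ) : ℂ) := fun s => by
      rw [Complex.mul_conj, Complex.normSq_eq_norm_sq]
    simp_rw [h2] at h0
    rw [integral_complex_ofReal] at h0
    exact_mod_cast h0
  have hcont : Continuous fun s => ‖u s‖ ^ 2 := by fun_prop
  have h3 := (integral_eq_zero_iff_of_nonneg (fun s => by positivity)
    (hcont.integrable_of_hasCompactSupport (HasCompactSupport.of_compactSpace _))).1 h1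
  have h4 := (Continuous.ae_eq_iff_eq (haarProb G) hcont continuous_zero).1 h3
  ext s
  have h5 : ‖u s‖ ^ 2 = 0 := congrFun h4 s
  simpa using h5

end Fourier

/-! ## The Beurling–Fourier space -/

section BeurlingFourier

variable {G : Type*} [Group G] [TopologicalSpace G] [IsTopologicalGroup G] [CompactSpace G]
  [MeasurableSpace G] [BorelSpace G]

/-- Formal trigonometric series `∏_π Trig_π(G)`. -/
abbrev FormalTrigSeries (G : Type*) [Group G] [TopologicalSpace G] : Type _ :=
  ∀ π : DualObject G, trigSpace π

/-- The summand `‖û(π)‖₁ d_π ω(π)`. -/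
def weightedTerm (ω : DualWeight G) (u : FormalTrigSeries G) (π : DualObject G) : ℝ :=
  traceNorm (fourierOp π (u π : C(G, ℂ))) * π.rep.dim * ω.toFun π

lemma weightedTerm_nonneg (ω : DualWeight G) (u : FormalTrigSeries G) (π : DualObject G) :
    0 ≤ weightedTerm ω u π :=
  mul_nonneg (mul_nonneg (traceNorm_nonneg _) (Nat.cast_nonneg _)) (ω.pos π).le

lemma weightedTerm_add_le (ω : DualWeight G) (u v : FormalTrigSeries G) (π : DualObject G) :
    weightedTerm ω (u + v) π ≤ weightedTerm ω u π + weightedTerm ω v π := by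
  have h := traceNorm_add_le (fourierOp π (u π : C(G, ℂ))) (fourierOp π (v π : C(G, ℂ)))
  simp only [weightedTerm, Pi.add_apply, Submodule.coe_add, map_add, ← add_mul]
  exact mul_le_mul_of_nonneg_right (mul_le_mul_of_nonneg_right h (Nat.cast_nonneg _)) (ω.pos π).le

lemma weightedTerm_smul (ω : DualWeight G) (c : ℂ) (u : FormalTrigSeries G) (π : DualObject G) :
    weightedTerm ω (c • u) π = ‖c‖ * weightedTerm ω u π := by
  simp only [weightedTerm, Pi.smul_apply, Submodule.coe_smul, map_smul, traceNorm_smul, mul_assoc]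

/-- The formal trigonometric series `u` with `∑_π ‖û(π)‖₁ d_π ω(π) < ∞`. -/
def beurlingFourierSubmodule (ω : DualWeight G) : Submodule ℂ (FormalTrigSeries G) where
  carrier := {u | Summable (weightedTerm ω u)}
  zero_mem' := by
    have : weightedTerm ω (0 : FormalTrigSeries G) = 0 := by
      ext π; simp [weightedTerm, traceNorm_zero]
    simp only [Set.mem_ofPred_eq, this]
    exact summable_zero
  add_mem' {u v} hu hv :=
    Summable.of_nonneg_of_le (weightedTerm_nonneg ω _) (weightedTerm_add_le ω u v)
      (Summable.add hu hv)
  smul_mem' c u hu := by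
    have : weightedTerm ω (c • u) = fun π => ‖c‖ * weightedTerm ω u π :=
      funext (weightedTerm_smul ω c u)
    simp only [Set.mem_ofPred_eq, this]
    exact Summable.mul_left _ hu

/-- The space `A_ω(G)`, normed by `‖u‖_ω = ∑_π ‖û(π)‖₁ d_π ω(π)`. -/
def BeurlingFourier (ω : DualWeight G) : Type _ := beurlingFourierSubmodule ω

namespace BeurlingFourier

variable (ω : DualWeight G)

instance : AddCommGroup (BeurlingFourier ω) :=
  inferInstanceAs (AddCommGroup (beurlingFourierSubmodule ω))

instance : Module ℂ (BeurlingFourier ω) :=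
  inferInstanceAs (Module ℂ (beurlingFourierSubmodule ω))

variable {ω}

/-- The component of `u` in `Trig_π(G)`. -/
def component (u : BeurlingFourier ω) (π : DualObject G) : C(G, ℂ) := (u.1 π : C(G, ℂ))

instance : Norm (BeurlingFourier ω) := ⟨fun u => ∑' π, weightedTerm ω u.1 π⟩

lemma normedSpaceCore : NormedSpace.Core ℂ (BeurlingFourier ω) where
  norm_nonneg u := tsum_nonneg (weightedTerm_nonneg ω u.1)
  norm_smul c u := by
    change ∑' π, weightedTerm ω (c • u.1) π = ‖c‖ * ∑' π, weightedTerm ω u.1 π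
    rw [← tsum_mul_left]
    exact tsum_congr (weightedTerm_smul ω c u.1)
  norm_triangle u v := by
    change ∑' π, weightedTerm ω (u.1 + v.1) π ≤ _
    refine ((u + v).2.tsum_le_tsum (weightedTerm_add_le ω u.1 v.1) (u.2.add v.2)).trans ?_
    exact (u.2.tsum_add v.2).le
  norm_eq_zero_iff u := by
    constructor
    · intro h
      have h0 := (u.2.hasSum_iff.2 h)
      have h1 := (hasSum_zero_iff_of_nonneg (weightedTerm_nonneg ω u.1)).1 h0
      apply Subtype.ext
      funext π
      apply Subtype.ext
      have h2 : weightedTerm ω u.1 π = 0 := congrFun h1 π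
      have hd : (π.rep.dim : ℝ) ≠ 0 := Nat.cast_ne_zero.2 π.rep.dim_pos.ne'
      rw [weightedTerm, mul_eq_zero, mul_eq_zero] at h2
      exact eq_zero_of_fourierOp_eq_zero (u.1 π).2 (eq_zero_of_traceNorm_eq_zero
        ((h2.resolve_right (ω.pos π).ne').resolve_right hd))
    · rintro rfl
      change ∑' π, weightedTerm ω (0 : FormalTrigSeries G) π = 0
      simp [weightedTerm, traceNorm_zero]

instance : NormedAddCommGroup (BeurlingFourier ω) :=
  NormedAddCommGroup.ofCore normedSpaceCore

instance : NormedSpace ℂ (BeurlingFourier ω) :=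
  NormedSpace.ofCore normedSpaceCore

/-- `u` is a trigonometric polynomial: only finitely many of its components are nonzero. -/
def IsTrigPoly (u : BeurlingFourier ω) : Prop := (Function.support u.component).Finite

/-- The function on `G` given by a trigonometric polynomial, i.e. the finite sum of its
components. -/
def polyFun (u : BeurlingFourier ω) : C(G, ℂ) := ∑ᶠ π, u.component π

end BeurlingFourier

/-! ## The algebra structure -/

/-- A commutative, associative, unital and submultiplicative bilinear product on `A_ω(G)` that
extends the pointwise product (and unit) of trigonometric polynomials. -/
@[ext]
structure BeurlingFourierProduct (ω : DualWeight G) where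
  mul : BeurlingFourier ω →ₗ[ℂ] BeurlingFourier ω →ₗ[ℂ] BeurlingFourier ω
  one : BeurlingFourier ω
  isTrigPoly_mul : ∀ u v, u.IsTrigPoly → v.IsTrigPoly → (mul u v).IsTrigPoly
  polyFun_mul : ∀ u v, u.IsTrigPoly → v.IsTrigPoly →
    (mul u v).polyFun = u.polyFun * v.polyFun
  isTrigPoly_one : one.IsTrigPoly
  polyFun_one : one.polyFun = 1
  norm_mul_le : ∀ u v, ‖mul u v‖ ≤ ‖u‖ * ‖v‖
  mul_comm : ∀ u v, mul u v = mul v u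
  mul_assoc : ∀ u v w, mul (mul u v) w = mul u (mul v w)
  one_mul : ∀ u, mul one u = u

/-- The space `A_ω(G)` with a given product; below it is made a commutative normed `ℂ`-algebra
with the norm of `A_ω(G)`. -/
def BeurlingFourierProduct.Alg {ω : DualWeight G} (_P : BeurlingFourierProduct ω) : Type _ :=
  BeurlingFourier ω

namespace BeurlingFourierProduct

variable {ω : DualWeight G} (P : BeurlingFourierProduct ω)

instance : NormedAddCommGroup P.Alg := inferInstanceAs (NormedAddCommGroup (BeurlingFourier ω))

instance : NormedSpace ℂ P.Alg := inferInstanceAs (NormedSpace ℂ (BeurlingFourier ω))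

instance : NormedCommRing P.Alg :=
  { (inferInstance : NormedAddCommGroup P.Alg) with
    mul := fun u v => P.mul u v
    one := P.one
    mul_comm := P.mul_comm
    mul_assoc := P.mul_assoc
    one_mul := P.one_mul
    mul_one := fun u => (P.mul_comm u P.one).trans (P.one_mul u)
    left_distrib := fun u v w => (P.mul u).map_add v w
    right_distrib := fun u v w => P.mul.map_add₂ u v w
    zero_mul := fun u => P.mul.map_zero₂ u
    mul_zero := fun u => (P.mul u).map_zero
    norm_mul_le := P.norm_mul_le }

instance : NormedAlgebra ℂ P.Alg :=
  { (Algebra.ofModule (A := P.Alg) (fun c u v => P.mul.map_smul₂ c u v)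
      (fun c u v => (P.mul u).map_smul c v) : Algebra ℂ P.Alg) with
    norm_smul_le := fun c u => norm_smul_le c u }

end BeurlingFourierProduct

end BeurlingFourier

end

/-! Since ω need not be bounded below, an element of A_ω(G) need not be a function on G, and point
evaluations are not available as characters. Semisimplicity comes instead from the right
translations R_s. They preserve each Trig_π(G), do not increase the norm, and act as algebra
endomorphisms. If u is in the radical and φ is a character, then φ ∘ R_s is again a character, so
φ(R_s u) = 0 for every s. As a function of s this is a uniformly convergent sum of the functions s ↦
φ(R_s u_π), which lie in Trig_π(G). Orthogonality of distinct classes makes each of them vanish, and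
s = 1 gives φ(u_π) = 0 (`apply_single_eq_zero`). Hence the radical contains the components of its
elements (`single_mem_jacobson`). If some component f is nonzero, the radical contains the
trigonometric polynomial f f̄, hence also its component at the trivial class, which is a constant
proportional to ∫ |f|² > 0. Then 1 is in the radical, which is absurd (`jacobson_eq_bot`).

The norm makes A_ω(G) the ℓ¹-sum of the finite-dimensional spaces Trig_π(G). This gives
completeness, and it lets bounded operators be prescribed and compared on components (`lift`,
`clm_ext`). The product therefore exists and is unique once it is contractive on Trig_π(G) ×
Trig_π'(G) (`norm_ofTrig_mul_le`). For that bound, f is written as a sum of coefficients ⟨π(s)x_k,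
y_k⟩ with ω(π) Σ ‖x_k‖‖y_k‖ equal to its norm. A product of two coefficients is a coefficient of π ⊗
π', which splits into irreducibles of weight at most ω(π)ω(π'). Cauchy–Schwarz over the summands
then loses no constant. -/

noncomputable section

/-! ### Schur's lemma. -/

namespace UnitaryIrrep

variable {G : Type*} [Group G] [TopologicalSpace G]

lemma mat_one (π : UnitaryIrrep G) : π.mat 1 = 1 := by simp [mat]

lemma mat_mul (π : UnitaryIrrep G) (s t : G) : π.mat (s * t) = π.mat s * π.mat t := by
  simp [mat]

lemma mat_inv (π : UnitaryIrrep G) (s : G) : π.mat s⁻¹ = (π.mat s)ᴴ := by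
  ext i j
  rw [mat_inv_apply, Matrix.conjTranspose_apply]; rfl

lemma mat_mem (π : UnitaryIrrep G) (s : G) : π.mat s ∈ Matrix.unitaryGroup (Fin π.dim) ℂ :=
  (π.hom s).2

lemma submodule_eq_bot_or_top (π : UnitaryIrrep G) (W : Submodule ℂ (Fin π.dim → ℂ))
    (h : ∀ s, ∀ v ∈ W, π.mat s *ᵥ v ∈ W) : W = ⊥ ∨ W = ⊤ := by
  have := π.irreducible
  let W' : Subrepresentation (unitaryRep π.hom) := ⟨W, fun s v hv => h s v hv⟩
  rcases this.eq_bot_or_eq_top W' with h | h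
  · exact Or.inl (congrArg Subrepresentation.toSubmodule h)
  · exact Or.inr (congrArg Subrepresentation.toSubmodule h)

/-- Schur's lemma: a matrix commuting with an irreducible representation is scalar. -/
theorem eq_smul_one_of_commute (π : UnitaryIrrep G) (T : Matrix (Fin π.dim) (Fin π.dim) ℂ)
    (h : ∀ s, π.mat s * T = T * π.mat s) : ∃ c : ℂ, T = c • 1 := by
  have : Nonempty (Fin π.dim) := ⟨⟨0, π.dim_pos⟩⟩
  obtain ⟨c, hc⟩ := Module.End.exists_eigenvalue (Matrix.toLin' T)
  refine ⟨c, ?_⟩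
  rcases π.submodule_eq_bot_or_top (Module.End.eigenspace (Matrix.toLin' T) c) (by
    intro s v hv
    rw [Module.End.mem_eigenspace_iff, Matrix.toLin'_apply] at hv ⊢
    rw [Matrix.mulVec_mulVec, ← h, ← Matrix.mulVec_mulVec, hv, Matrix.mulVec_smul]) with h | h
  · exact absurd h hc
  · apply Matrix.toLin'.injective
    ext1 i
    have : Pi.single i (1 : ℂ) ∈ Module.End.eigenspace (Matrix.toLin' T) c := by
      rw [h]; trivial
    rw [Module.End.mem_eigenspace_iff] at this
    ext1
    simpa using this

open scoped ComplexOrder in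
/-- Schur's lemma: a nonzero intertwiner can be normalized to a unitary equivalence. -/
theorem equivalent_of_intertwiner {σ π : UnitaryIrrep G}
    {T : Matrix (Fin π.dim) (Fin σ.dim) ℂ} (h : ∀ s, π.mat s * T = T * σ.mat s) (hT : T ≠ 0) :
    Equivalent σ π := by
  have h' : ∀ s, σ.mat s * Tᴴ = Tᴴ * π.mat s := fun s => by
    have := congrArg Matrix.conjTranspose (h s⁻¹)
    simpa [mat_inv] using this.symm
  obtain ⟨c, hc⟩ := σ.eq_smul_one_of_commute (Tᴴ * T) fun s => by
    rw [← Matrix.mul_assoc, h', Matrix.mul_assoc, h, Matrix.mul_assoc]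
  obtain ⟨c', hc'⟩ := π.eq_smul_one_of_commute (T * Tᴴ) fun s => by
    rw [← Matrix.mul_assoc, h, Matrix.mul_assoc, h', Matrix.mul_assoc]
  -- Compare the two ways of bracketing T Tᴴ T.
  have hcc : c' = c := by
    have : (T * Tᴴ) * T = T * (Tᴴ * T) := Matrix.mul_assoc _ _ _
    rw [hc, hc', Matrix.smul_mul, Matrix.mul_smul, Matrix.one_mul, Matrix.mul_one] at this
    have h0 : (c' - c) • T = 0 := by rw [sub_smul, this, sub_self]
    exact sub_eq_zero.1 ((smul_eq_zero.1 h0).resolve_right hT)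
  subst hcc
  have hc0 : c' ≠ 0 := by
    rintro rfl
    rw [zero_smul] at hc
    exact hT (Matrix.conjTranspose_mul_self_eq_zero.1 hc)
  -- The scalar is a diagonal entry of the positive semidefinite matrix Tᴴ T, so T divided by its
  -- square root is unitary.
  have hr : 0 ≤ c' := by
    have h1 := (Matrix.posSemidef_conjTranspose_mul_self T).diag_nonneg (i := ⟨0, σ.dim_pos⟩)
    rw [hc] at h1
    simpa using h1
  obtain ⟨r, hr0, rfl⟩ : ∃ r : ℝ, 0 ≤ r ∧ (r : ℂ) = c' := by
    rw [Complex.nonneg_iff] at hr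
    exact ⟨c'.re, hr.1, Complex.ext rfl hr.2⟩
  have hs : (((√r)⁻¹ : ℝ) : ℂ) * (((√r)⁻¹ : ℝ) : ℂ) * r = 1 := by
    have h2 : r ≠ 0 := by simpa using hc0
    rw [← Complex.ofReal_mul, ← Complex.ofReal_mul, ← mul_inv, Real.mul_self_sqrt hr0,
      inv_mul_cancel₀ h2, Complex.ofReal_one]
  refine ⟨(((√r)⁻¹ : ℝ) : ℂ) • T, ?_, ?_, fun s => ?_⟩
  · rw [Matrix.conjTranspose_smul, Matrix.smul_mul, Matrix.mul_smul, hc, smul_smul, smul_smul]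
    simp only [RCLike.star_def, Complex.conj_ofReal]
    rw [hs, one_smul]
  · rw [Matrix.conjTranspose_smul, Matrix.smul_mul, Matrix.mul_smul, hc', smul_smul, smul_smul]
    simp only [RCLike.star_def, Complex.conj_ofReal]
    rw [hs, one_smul]
  · rw [Matrix.mul_smul, h, Matrix.smul_mul]

end UnitaryIrrep

/-! ### Complete reducibility of unitary matrix representations. -/

section Decomposition

variable {G : Type*} [Group G]

/-- The representation obtained from `ρ` by restriction to the range of an isometry `V` whose range
projection commutes with `ρ`. -/
def compress {ι : Type*} [Fintype ι] [DecidableEq ι] {n : ℕ} (ρ : G →* Matrix.unitaryGroup ι ℂ)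
    (V : Matrix ι (Fin n) ℂ) (hV : Vᴴ * V = 1)
    (hc : ∀ s, (ρ s).1 * (V * Vᴴ) = (V * Vᴴ) * (ρ s).1) : G →* Matrix.unitaryGroup (Fin n) ℂ :=
  have key : ∀ s, V * (Vᴴ * (ρ s).1 * V) = (ρ s).1 * V := fun s => by
    rw [← Matrix.mul_assoc, ← Matrix.mul_assoc, ← hc, Matrix.mul_assoc, Matrix.mul_assoc, hV,
      Matrix.mul_one]
  { toFun s := ⟨Vᴴ * (ρ s).1 * V, by
      rw [Matrix.mem_unitaryGroup_iff', Matrix.star_eq_conjTranspose, Matrix.conjTranspose_mul,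
        Matrix.conjTranspose_mul, Matrix.conjTranspose_conjTranspose, Matrix.mul_assoc,
        Matrix.mul_assoc, key, ← Matrix.mul_assoc ((ρ s).1)ᴴ, ← Matrix.star_eq_conjTranspose (ρ s).1,
        Matrix.mem_unitaryGroup_iff'.1 (ρ s).2, Matrix.one_mul, hV]⟩
    map_one' := by ext1; simp [hV]
    map_mul' s t := by
      ext1
      simp only [map_mul, Submonoid.coe_mul]
      rw [Matrix.mul_assoc (Vᴴ * (ρ s).1), key]
      simp only [Matrix.mul_assoc] }

lemma mul_compress {ι : Type*} [Fintype ι] [DecidableEq ι] {n : ℕ}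
    (ρ : G →* Matrix.unitaryGroup ι ℂ)
    (V : Matrix ι (Fin n) ℂ) (hV : Vᴴ * V = 1)
    (hc : ∀ s, (ρ s).1 * (V * Vᴴ) = (V * Vᴴ) * (ρ s).1) (s : G) :
    (ρ s).1 * V = V * (compress ρ V hV hc s).1 := by
  change _ = V * (Vᴴ * (ρ s).1 * V)
  rw [← Matrix.mul_assoc, ← Matrix.mul_assoc, ← hc, Matrix.mul_assoc, Matrix.mul_assoc, hV,
      Matrix.mul_one]

/-- The inclusion of a subspace of `ℂⁿ`, as a matrix with orthonormal columns. -/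
def inclusionMatrix {n : ℕ} (W : Submodule ℂ (EuclideanSpace ℂ (Fin n))) :
    Matrix (Fin n) (Fin (Module.finrank ℂ W)) ℂ :=
  Matrix.of fun x j => ((stdOrthonormalBasis ℂ W j : W) : EuclideanSpace ℂ (Fin n)) x

lemma conjTranspose_mul_inclusionMatrix {n : ℕ} (W : Submodule ℂ (EuclideanSpace ℂ (Fin n))) :
    (inclusionMatrix W)ᴴ * inclusionMatrix W = 1 := by
  ext i j
  have := (orthonormal_iff_ite.1 (stdOrthonormalBasis ℂ W).orthonormal) i j
  rw [Submodule.coe_inner, PiLp.inner_apply] at this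
  rw [Matrix.mul_apply, Matrix.one_apply, ← this]
  refine Finset.sum_congr rfl fun x _ => ?_
  simp [inclusionMatrix, mul_comm]

/-- Identifies V Vᴴ with the orthogonal projection onto W, so that facts about projections become
matrix identities. -/
lemma inclusionMatrix_mulVec {n : ℕ} (W : Submodule ℂ (EuclideanSpace ℂ (Fin n)))
    (v : EuclideanSpace ℂ (Fin n)) :
    (inclusionMatrix W * (inclusionMatrix W)ᴴ) *ᵥ v.ofLp = (W.starProjection v).ofLp := by
  have h := (stdOrthonormalBasis ℂ W).sum_repr' (W.orthogonalProjectionOnto v)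
  have h2 : (W.starProjection v) =
      ∑ i, ⟪((stdOrthonormalBasis ℂ W i : W) : EuclideanSpace ℂ (Fin n)), v⟫_ℂ •
        ((stdOrthonormalBasis ℂ W i : W) : EuclideanSpace ℂ (Fin n)) := by
    rw [Submodule.starProjection_apply, ← h]
    simp
  rw [h2, ← Matrix.mulVec_mulVec]
  ext x
  simp only [Matrix.mulVec, dotProduct, inclusionMatrix, Matrix.conjTranspose_apply, Matrix.of_apply,
    WithLp.ofLp_sum, Finset.sum_apply, WithLp.ofLp_smul, Pi.smul_apply, smul_eq_mul,
    PiLp.inner_apply]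
  refine Finset.sum_congr rfl fun j _ => ?_
  rw [mul_comm]
  congr 1
  refine Finset.sum_congr rfl fun y _ => ?_
  simp [mul_comm]

lemma inclusionMatrix_add_orthogonal {n : ℕ} (W : Submodule ℂ (EuclideanSpace ℂ (Fin n))) :
    inclusionMatrix W * (inclusionMatrix W)ᴴ + inclusionMatrix Wᗮ * (inclusionMatrix Wᗮ)ᴴ = 1 := by
  refine Matrix.ext_of_mulVec_single fun i => ?_
  have h1 := inclusionMatrix_mulVec W (WithLp.toLp 2 (Pi.single i 1))
  have h2 := inclusionMatrix_mulVec Wᗮ (WithLp.toLp 2 (Pi.single i 1))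
  rw [Matrix.add_mulVec, h1, h2, ← WithLp.ofLp_add,
    Submodule.starProjection_add_starProjection_orthogonal,
    Matrix.one_mulVec]

/-- For the projection P onto W, invariance reads P ρ(s) P = ρ(s) P. The adjoint of this identity at
s⁻¹ is P ρ(s) P = P ρ(s), by unitarity. -/
lemma commute_of_invariant {n : ℕ} (ρ : G →* Matrix.unitaryGroup (Fin n) ℂ)
    (W : Submodule ℂ (EuclideanSpace ℂ (Fin n)))
    (h : ∀ s, ∀ v ∈ W, WithLp.toLp 2 ((ρ s).1 *ᵥ v.ofLp) ∈ W) (s : G) :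
    (ρ s).1 * (inclusionMatrix W * (inclusionMatrix W)ᴴ) =
      (inclusionMatrix W * (inclusionMatrix W)ᴴ) * (ρ s).1 := by
  have hPs : (inclusionMatrix W * (inclusionMatrix W)ᴴ)ᴴ =
      inclusionMatrix W * (inclusionMatrix W)ᴴ := by simp
  have hmul := inclusionMatrix_mulVec W
  generalize inclusionMatrix W * (inclusionMatrix W)ᴴ = P at hPs hmul ⊢
  have key : ∀ s, P * (ρ s).1 * P = (ρ s).1 * P := fun s => by
    refine Matrix.ext_of_mulVec_single fun i => ?_
    have h1 := hmul (WithLp.toLp 2 (Pi.single i 1))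
    have h2 := h s _ (W.starProjection_apply_mem (WithLp.toLp 2 (Pi.single i 1)))
    have h3 := hmul (WithLp.toLp 2 ((ρ s).1 *ᵥ
      (W.starProjection (WithLp.toLp 2 (Pi.single i 1))).ofLp))
    rw [Submodule.starProjection_eq_self_iff.2 h2] at h3
    rw [← Matrix.mulVec_mulVec, ← Matrix.mulVec_mulVec, ← Matrix.mulVec_mulVec, h1]
    exact h3
  have hinv : ((ρ s⁻¹).1)ᴴ = (ρ s).1 := by
    have : ρ s⁻¹ = star (ρ s) := by rw [map_inv]; rfl
    rw [this]
    simp [Matrix.star_eq_conjTranspose]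
  have := congrArg Matrix.conjTranspose (key s⁻¹)
  simp only [Matrix.conjTranspose_mul, hPs, hinv] at this
  rw [← this, ← Matrix.mul_assoc, key]

variable [TopologicalSpace G]

lemma continuous_compress {ι : Type*} [Fintype ι] [DecidableEq ι] {n : ℕ}
    {ρ : G →* Matrix.unitaryGroup ι ℂ} (hρ : Continuous ρ)
    (V : Matrix ι (Fin n) ℂ) (hV : Vᴴ * V = 1)
    (hc : ∀ s, (ρ s).1 * (V * Vᴴ) = (V * Vᴴ) * (ρ s).1) : Continuous (compress ρ V hV hc) := by
  refine Continuous.subtype_mk ?_ _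
  have : Continuous fun s => (ρ s).1 := continuous_subtype_val.comp hρ
  fun_prop

/-- `ρ` is an orthogonal direct sum of irreducible representations, embedded by the isometries
`V i`. -/
def IsCompletelyDecomposable {ι : Type*} [Fintype ι] [DecidableEq ι]
    (ρ : G →* Matrix.unitaryGroup ι ℂ) : Prop :=
  ∃ (κ : Type) (_ : Fintype κ) (σ : κ → DualObject G) (V : ∀ i, Matrix ι (Fin (σ i).rep.dim) ℂ),
    (∀ i, (V i)ᴴ * V i = 1) ∧ (∀ i s, (ρ s).1 * V i = V i * (σ i).rep.mat s) ∧
      ∑ i, V i * (V i)ᴴ = 1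

lemma isCompletelyDecomposable_of_isIrreducible {n : ℕ} (ρ : G →* Matrix.unitaryGroup (Fin n) ℂ)
    (hρ : Continuous ρ) (h : (unitaryRep ρ).IsIrreducible) : IsCompletelyDecomposable ρ := by
  let π : UnitaryIrrep G := ⟨n, ρ, hρ, h⟩
  obtain ⟨V, h1, h2, h3⟩ : UnitaryIrrep.Equivalent (DualObject.rep ⟦π⟧) π :=
    Quotient.exact (Quotient.out_eq ⟦π⟧)
  exact ⟨Unit, inferInstance, fun _ => ⟦π⟧, fun _ => V, fun _ => h1, fun _ s => h3 s,
    by simpa using h2⟩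

lemma isCompletelyDecomposable_of_compress {ι κ : Type} [Fintype ι] [DecidableEq ι] [Fintype κ]
    {ρ : G →* Matrix.unitaryGroup ι ℂ} {n : κ → ℕ} (V : ∀ k, Matrix ι (Fin (n k)) ℂ)
    (hV : ∀ k, (V k)ᴴ * V k = 1)
    (hc : ∀ k s, (ρ s).1 * (V k * (V k)ᴴ) = (V k * (V k)ᴴ) * (ρ s).1)
    (hsum : ∑ k, V k * (V k)ᴴ = 1)
    (h : ∀ k, IsCompletelyDecomposable (compress ρ (V k) (hV k) (hc k))) :
    IsCompletelyDecomposable ρ := by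
  choose κ' hκ' σ W h1 h2 h3 using h
  refine ⟨Σ k, κ' k, inferInstance, fun p => σ p.1 p.2, fun p => V p.1 * W p.1 p.2, ?_, ?_, ?_⟩
  · rintro ⟨k, i⟩
    rw [Matrix.conjTranspose_mul, Matrix.mul_assoc, ← Matrix.mul_assoc _ (V k), hV, Matrix.one_mul,
      h1]
  · rintro ⟨k, i⟩ s
    rw [← Matrix.mul_assoc, mul_compress ρ (V k) (hV k) (hc k), Matrix.mul_assoc, h2,
      Matrix.mul_assoc]
  · rw [Fintype.sum_sigma, ← hsum]
    refine Finset.sum_congr rfl fun k _ => ?_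
    simp only [Matrix.conjTranspose_mul]
    calc ∑ i, V k * W k i * ((W k i)ᴴ * (V k)ᴴ) = V k * (∑ i, W k i * (W k i)ᴴ) * (V k)ᴴ := by
          simp only [Matrix.mul_sum, Matrix.sum_mul, Matrix.mul_assoc]
      _ = _ := by rw [h3, Matrix.mul_one]

/-- Induction on the dimension: a proper nonzero invariant subspace W and its orthogonal complement
both reduce ρ and both have smaller dimension. -/
theorem isCompletelyDecomposable_fin (n : ℕ) (ρ : G →* Matrix.unitaryGroup (Fin n) ℂ)
    (hρ : Continuous ρ) : IsCompletelyDecomposable ρ := by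
  induction n using Nat.strong_induction_on with
  | _ n ih =>
  by_cases hirr : (unitaryRep ρ).IsIrreducible
  · exact isCompletelyDecomposable_of_isIrreducible ρ hρ hirr
  -- The zero representation is not irreducible; it is the empty direct sum.
  rcases Nat.eq_zero_or_pos n with rfl | hn
  · exact ⟨Empty, inferInstance, fun i => i.elim, fun i => i.elim, fun i => i.elim,
      fun i => i.elim, Subsingleton.elim _ _⟩
  have : Nonempty (Fin n) := ⟨⟨0, hn⟩⟩
  have hnt : Nontrivial (Subrepresentation (unitaryRep ρ)) := by
    refine ⟨⊥, ⊤, fun h => ?_⟩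
    have := congrArg Subrepresentation.toSubmodule h
    exact bot_ne_top (α := Submodule ℂ (Fin n → ℂ)) this
  obtain ⟨U, hU0, hU1⟩ : ∃ U : Subrepresentation (unitaryRep ρ), U ≠ ⊥ ∧ U ≠ ⊤ := by
    by_contra! hcon
    exact hirr ⟨fun U => or_iff_not_imp_left.2 (hcon U)⟩
  let W : Submodule ℂ (EuclideanSpace ℂ (Fin n)) :=
    U.toSubmodule.comap (WithLp.linearEquiv 2 ℂ (Fin n → ℂ)).toLinearMap
  have hWinv : ∀ s, ∀ v ∈ W, WithLp.toLp 2 ((ρ s).1 *ᵥ v.ofLp) ∈ W := fun s v hv =>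
    U.apply_mem_toSubmodule s hv
  have hW0 : W ≠ ⊥ := fun h => hU0 <| by
    apply Subrepresentation.toSubmodule_injective
    refine (Submodule.eq_bot_iff _).2 fun x hx => ?_
    have : WithLp.toLp 2 x ∈ W := hx
    rw [h, Submodule.mem_bot] at this
    simpa using this
  have hW1 : W ≠ ⊤ := fun h => hU1 <| by
    apply Subrepresentation.toSubmodule_injective
    refine Submodule.eq_top_iff'.2 fun x => ?_
    have : WithLp.toLp 2 x ∈ W := by rw [h]; trivial
    exact this
  have hsum := inclusionMatrix_add_orthogonal W
  have hcW := commute_of_invariant ρ W hWinv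
  have hcO : ∀ s, (ρ s).1 * (inclusionMatrix Wᗮ * (inclusionMatrix Wᗮ)ᴴ) =
      (inclusionMatrix Wᗮ * (inclusionMatrix Wᗮ)ᴴ) * (ρ s).1 := fun s => by
    rw [← eq_sub_iff_add_eq'] at hsum
    rw [hsum, Matrix.mul_sub, Matrix.sub_mul, hcW, Matrix.mul_one, Matrix.one_mul]
  have hfin : Module.finrank ℂ (EuclideanSpace ℂ (Fin n)) = n := by simp
  have hadd := W.finrank_add_finrank_orthogonal
  rw [hfin] at hadd
  have hpos : 0 < Module.finrank ℂ W := Nat.pos_of_ne_zero fun h => hW0 (Submodule.finrank_eq_zero.1 h)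
  have hlt : Module.finrank ℂ W < n := by
    have := Submodule.finrank_lt hW1
    rwa [hfin] at this
  let S : Bool → Submodule ℂ (EuclideanSpace ℂ (Fin n)) := fun b => bif b then W else Wᗮ
  refine isCompletelyDecomposable_of_compress (κ := Bool) (fun b => inclusionMatrix (S b))
    (fun b => conjTranspose_mul_inclusionMatrix _) (fun b => ?_) ?_ fun b => ?_
  · cases b
    · exact hcO
    · exact hcW
  · rw [Fintype.sum_bool]; exact hsum
  · refine ih _ ?_ _ (continuous_compress hρ _ _ _)
    cases b
    · change Module.finrank ℂ Wᗮ < n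
      omega
    · exact hlt

/-- Complete reducibility of continuous finite-dimensional unitary representations. -/
theorem isCompletelyDecomposable {ι : Type} [Fintype ι] [DecidableEq ι]
    (ρ : G →* Matrix.unitaryGroup ι ℂ) (hρ : Continuous ρ) : IsCompletelyDecomposable ρ := by
  let e := Fintype.equivFin ι
  -- The reindexing ι ≃ Fin n, seen as a unitary matrix, transports the case of `Fin n` to ι.
  have h1 : ((1 : Matrix ι ι ℂ).submatrix id e.symm)ᴴ * (1 : Matrix ι ι ℂ).submatrix id e.symm =
      1 := by
    rw [Matrix.conjTranspose_submatrix, ← Matrix.submatrix_mul _ _ _ _ _ Function.bijective_id]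
    simp
  have h2 : (1 : Matrix ι ι ℂ).submatrix id e.symm * ((1 : Matrix ι ι ℂ).submatrix id e.symm)ᴴ =
      1 := by
    rw [Matrix.conjTranspose_submatrix, ← Matrix.submatrix_mul _ _ _ _ _ e.symm.bijective]
    simp
  exact isCompletelyDecomposable_of_compress (κ := Unit) (n := fun _ => Fintype.card ι)
    (fun _ => (1 : Matrix ι ι ℂ).submatrix id e.symm) (fun _ => h1)
    (fun _ s => by rw [h2, Matrix.mul_one, Matrix.one_mul]) (by simp)
    fun _ => isCompletelyDecomposable_fin _ _ (continuous_compress hρ _ _ _)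

end Decomposition

/-! ### Schur orthogonality and Fourier inversion on Trig_π(G). -/

section SchurOrthogonality

variable {G : Type*} [Group G] [TopologicalSpace G]

lemma UnitaryIrrep.continuous_mat_apply (π : UnitaryIrrep G) (i j : Fin π.dim) :
    Continuous fun s => π.mat s i j :=
  (matrixCoeff π i j).continuous

lemma matrixCoeff_mem (π : DualObject G) (i j : Fin π.rep.dim) :
    matrixCoeff π.rep i j ∈ trigSpace π :=
  Submodule.subset_span ⟨(i, j), rfl⟩

variable [IsTopologicalGroup G] [CompactSpace G]
  [MeasurableSpace G] [BorelSpace G]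

lemma integrable_haarProb {f : G → ℂ} (hf : Continuous f) : Integrable f (haarProb G) :=
  hf.integrable_of_hasCompactSupport (HasCompactSupport.of_compactSpace _)

/-- The matrix `∫ π(s) E σ(s⁻¹) ds`, where `E` is the elementary matrix at `(l, i)`. -/
def averagedIntertwiner (π σ : UnitaryIrrep G) (l : Fin π.dim) (i : Fin σ.dim) :
    Matrix (Fin π.dim) (Fin σ.dim) ℂ :=
  Matrix.of fun k j => ∫ s, π.mat s k l * σ.mat s⁻¹ i j ∂haarProb G

lemma averagedIntertwiner_integrable (π σ : UnitaryIrrep G) (l k : Fin π.dim) (i j : Fin σ.dim) :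
    Integrable (fun s => π.mat s k l * σ.mat s⁻¹ i j) (haarProb G) :=
  integrable_haarProb ((π.continuous_mat_apply k l).mul
    ((σ.continuous_mat_apply i j).comp continuous_inv))

lemma mul_averagedIntertwiner (π σ : UnitaryIrrep G) (l : Fin π.dim) (i : Fin σ.dim) (t : G) :
    π.mat t * averagedIntertwiner π σ l i = averagedIntertwiner π σ l i * σ.mat t := by
  ext k j
  calc (π.mat t * averagedIntertwiner π σ l i) k j
      = ∫ s, π.mat (t * s) k l * σ.mat s⁻¹ i j ∂haarProb G := by
        simp only [Matrix.mul_apply, averagedIntertwiner, Matrix.of_apply, UnitaryIrrep.mat_mul,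
          Finset.sum_mul, mul_assoc]
        rw [integral_finsetSum _ fun m _ =>
          (averagedIntertwiner_integrable π σ l m i j).const_mul (π.mat t k m)]
        exact Finset.sum_congr rfl fun m _ => (integral_const_mul _ _).symm
    _ = ∫ s, π.mat s k l * σ.mat (s⁻¹ * t) i j ∂haarProb G := by
        -- Left invariance of Haar measure: replacing s by ts turns s⁻¹t into s⁻¹.
        rw [← integral_mul_left_eq_self (fun s => π.mat s k l * σ.mat (s⁻¹ * t) i j) t]
        simp
    _ = (averagedIntertwiner π σ l i * σ.mat t) k j := by
        simp only [Matrix.mul_apply, averagedIntertwiner, Matrix.of_apply, UnitaryIrrep.mat_mul,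
          Finset.mul_sum, ← mul_assoc]
        rw [integral_finsetSum _ fun m _ =>
          (averagedIntertwiner_integrable π σ l k i m).mul_const (σ.mat t m j)]
        exact Finset.sum_congr rfl fun m _ => integral_mul_const _ _

lemma averagedIntertwiner_eq_zero {π σ : UnitaryIrrep G} (h : ¬ UnitaryIrrep.Equivalent σ π)
    (l : Fin π.dim) (i : Fin σ.dim) : averagedIntertwiner π σ l i = 0 := by
  by_contra h0
  exact h (UnitaryIrrep.equivalent_of_intertwiner (mul_averagedIntertwiner π σ l i) h0)

/-- The average commutes with π, hence is scalar, and the scalar is read off from the trace, which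
averaging by conjugation preserves. -/
lemma averagedIntertwiner_self (π : UnitaryIrrep G) (l i : Fin π.dim) :
    averagedIntertwiner π π l i = if i = l then (π.dim : ℂ)⁻¹ • 1 else 0 := by
  obtain ⟨c, hc⟩ := π.eq_smul_one_of_commute _ (mul_averagedIntertwiner π π l i)
  have hd : (π.dim : ℂ) ≠ 0 := Nat.cast_ne_zero.2 π.dim_pos.ne'
  have htr : (averagedIntertwiner π π l i).trace = if i = l then 1 else 0 := by
    simp only [Matrix.trace, Matrix.diag_apply, averagedIntertwiner, Matrix.of_apply]
    rw [← integral_finsetSum _ fun m _ => averagedIntertwiner_integrable π π l m i m]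
    have : ∀ s, ∑ m, π.mat s m l * π.mat s⁻¹ i m = if i = l then 1 else 0 := fun s => by
      rw [← Matrix.one_apply, ← π.mat_one, ← inv_mul_cancel s, π.mat_mul, Matrix.mul_apply]
      exact Finset.sum_congr rfl fun m _ => mul_comm _ _
    simp_rw [this]
    simp
  rw [hc] at htr ⊢
  simp only [Matrix.trace_smul, Matrix.trace_one, Fintype.card_fin, smul_eq_mul] at htr
  split_ifs at htr ⊢ with h
  · rw [eq_inv_of_mul_eq_one_left htr]
  · rw [(mul_eq_zero.1 htr).resolve_right hd, zero_smul]

lemma fourierOp_matrixCoeff_of_ne {π σ : DualObject G} (h : π ≠ σ) (k l : Fin π.rep.dim) :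
    fourierOp σ (matrixCoeff π.rep k l) = 0 := by
  ext i j
  -- Entry (i, j) of this Fourier coefficient is by definition entry (k, j) of the average of the
  -- elementary matrix at (l, i).
  exact congrFun (congrFun (averagedIntertwiner_eq_zero
    (fun h' => h (Quotient.out_equiv_out.1 h').symm) l i) k) j

lemma fourierOp_matrixCoeff_self (π : DualObject G) (k l : Fin π.rep.dim) :
    fourierOp π (matrixCoeff π.rep k l) = (π.rep.dim : ℂ)⁻¹ • Matrix.single l k 1 := by
  ext i j
  have : fourierOp π (matrixCoeff π.rep k l) i j = averagedIntertwiner π.rep π.rep l i k j := rfl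
  rw [this, averagedIntertwiner_self]
  by_cases h : i = l
  · subst h; simp [Matrix.one_apply, Matrix.single_apply]
  · simp [h, Ne.symm h]

/-- The projection `u ↦ (s ↦ d_π tr(û(π) π(s)))` of `C(G)` onto `Trig_π(G)`. -/
def isotypicPart (π : DualObject G) : C(G, ℂ) →ₗ[ℂ] trigSpace π where
  toFun u := ⟨(π.rep.dim : ℂ) • ∑ i, ∑ j, fourierOp π u i j • matrixCoeff π.rep j i,
    Submodule.smul_mem _ _ (Submodule.sum_mem _ fun _ _ => Submodule.sum_mem _ fun _ _ =>
      Submodule.smul_mem _ _ (matrixCoeff_mem π _ _))⟩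
  map_add' u v := by
    ext1
    simp only [map_add, Matrix.add_apply, add_smul, Finset.sum_add_distrib, smul_add,
      Submodule.coe_add]
  map_smul' c u := by
    ext1
    simp only [map_smul, Matrix.smul_apply, smul_eq_mul, mul_smul, ← Finset.smul_sum,
      RingHom.id_apply, Submodule.coe_smul]
    rw [smul_comm]

lemma isotypicPart_eq (π : DualObject G) (u : C(G, ℂ)) :
    (isotypicPart π u : C(G, ℂ)) =
      (π.rep.dim : ℂ) • ∑ i, ∑ j, fourierOp π u i j • matrixCoeff π.rep j i := rfl

/-- Fourier inversion on `Trig_π(G)`. -/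
lemma isotypicPart_of_mem {π : DualObject G} {u : C(G, ℂ)} (hu : u ∈ trigSpace π) :
    (isotypicPart π u : C(G, ℂ)) = u := by
  have hd : (π.rep.dim : ℂ) ≠ 0 := Nat.cast_ne_zero.2 π.rep.dim_pos.ne'
  induction hu using Submodule.span_induction with
  | mem x hx =>
    obtain ⟨⟨k, l⟩, rfl⟩ := hx
    rw [isotypicPart_eq, fourierOp_matrixCoeff_self]
    simp only [Matrix.smul_apply, smul_eq_mul, mul_smul, ← Finset.smul_sum]
    rw [smul_inv_smul₀ hd]
    simp [Matrix.single_apply, ite_and]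
  | zero => simp
  | add x y _ _ hx hy => rw [map_add, Submodule.coe_add, hx, hy]
  | smul c x _ hx => rw [map_smul, Submodule.coe_smul, hx]

lemma fourierOp_of_mem_of_ne {π σ : DualObject G} (h : π ≠ σ) {u : C(G, ℂ)}
    (hu : u ∈ trigSpace π) : fourierOp σ u = 0 := by
  induction hu using Submodule.span_induction with
  | mem x hx =>
    obtain ⟨⟨k, l⟩, rfl⟩ := hx
    exact fourierOp_matrixCoeff_of_ne h k l
  | zero => simp
  | add x y _ _ hx hy => rw [map_add, hx, hy, add_zero]
  | smul c x _ hx => rw [map_smul, hx, smul_zero]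

lemma isotypicPart_of_mem_of_ne {π σ : DualObject G} (h : π ≠ σ) {u : C(G, ℂ)}
    (hu : u ∈ trigSpace π) : isotypicPart σ u = 0 := by
  ext1
  simp [isotypicPart_eq, fourierOp_of_mem_of_ne h hu]

end SchurOrthogonality

/-! ### Coefficient functions and their decomposition along a direct sum. -/

section Coefficients

variable {G : Type*} [Group G] [TopologicalSpace G]

/-- The coefficient function `s ↦ ⟨ρ(s) ξ, η⟩` of a continuous unitary representation. -/
def repCoeff {ι : Type*} [Fintype ι] [DecidableEq ι] (ρ : G →* Matrix.unitaryGroup ι ℂ)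
    (hρ : Continuous ρ) (ξ η : ι → ℂ) : C(G, ℂ) where
  toFun s := star η ⬝ᵥ ((ρ s).1 *ᵥ ξ)
  continuous_toFun := by
    have : Continuous fun s => (ρ s).1 := continuous_subtype_val.comp hρ
    fun_prop

lemma repCoeff_apply {ι : Type*} [Fintype ι] [DecidableEq ι] (ρ : G →* Matrix.unitaryGroup ι ℂ)
    (hρ : Continuous ρ) (ξ η : ι → ℂ) (s : G) :
    repCoeff ρ hρ ξ η s = star η ⬝ᵥ ((ρ s).1 *ᵥ ξ) := rfl

/-- The coefficient function `s ↦ ⟨π(s) ξ, η⟩` of an irreducible representation. -/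
abbrev UnitaryIrrep.coeff (π : UnitaryIrrep G) (ξ η : Fin π.dim → ℂ) : C(G, ℂ) :=
  repCoeff π.hom π.continuous_hom ξ η

lemma UnitaryIrrep.coeff_eq_sum (π : UnitaryIrrep G) (ξ η : Fin π.dim → ℂ) :
    π.coeff ξ η = ∑ i, ∑ j, (star (η i) * ξ j) • matrixCoeff π i j := by
  ext s
  simp only [repCoeff_apply, dotProduct, Matrix.mulVec, Finset.mul_sum, ContinuousMap.sum_apply,
    ContinuousMap.smul_apply, matrixCoeff_apply, smul_eq_mul, UnitaryIrrep.mat, Pi.star_apply]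
  exact Finset.sum_congr rfl fun i _ => Finset.sum_congr rfl fun j _ => by ring

lemma UnitaryIrrep.matrixCoeff_eq_coeff (π : UnitaryIrrep G) (i j : Fin π.dim) :
    matrixCoeff π i j = π.coeff (Pi.single j 1) (Pi.single i 1) := by
  ext s
  simp [repCoeff_apply, matrixCoeff_apply, UnitaryIrrep.mat]

lemma coeff_mem (π : DualObject G) (ξ η : Fin π.rep.dim → ℂ) :
    π.rep.coeff ξ η ∈ trigSpace π := by
  rw [UnitaryIrrep.coeff_eq_sum]
  exact Submodule.sum_mem _ fun i _ => Submodule.sum_mem _ fun j _ =>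
    Submodule.smul_mem _ _ (Submodule.subset_span ⟨(i, j), rfl⟩)

/-- The coefficient function of a direct sum is the sum of the coefficient functions of the
summands. -/
lemma repCoeff_eq_sum {ι κ : Type*} [Fintype ι] [DecidableEq ι] [Fintype κ]
    {ρ : G →* Matrix.unitaryGroup ι ℂ} (hρ : Continuous ρ) {σ : κ → UnitaryIrrep G}
    {V : ∀ i, Matrix ι (Fin (σ i).dim) ℂ} (h : ∀ i s, (ρ s).1 * V i = V i * (σ i).mat s)
    (hsum : ∑ i, V i * (V i)ᴴ = 1) (ξ η : ι → ℂ) :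
    repCoeff ρ hρ ξ η = ∑ i, (σ i).coeff ((V i)ᴴ *ᵥ ξ) ((V i)ᴴ *ᵥ η) := by
  ext s
  rw [ContinuousMap.sum_apply]
  have h1 : (ρ s).1 = ∑ i, V i * (σ i).mat s * (V i)ᴴ := by
    rw [← Matrix.mul_one (ρ s).1, ← hsum, Matrix.mul_sum]
    exact Finset.sum_congr rfl fun i _ => by rw [← Matrix.mul_assoc, h]
  rw [repCoeff_apply, h1, Matrix.sum_mulVec, dotProduct_sum]
  refine Finset.sum_congr rfl fun i _ => ?_
  rw [repCoeff_apply, Matrix.star_mulVec, Matrix.conjTranspose_conjTranspose,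
    ← Matrix.mulVec_mulVec, ← Matrix.mulVec_mulVec, ← Matrix.dotProduct_mulVec]
  rfl

lemma ofReal_norm_sq_eq_dotProduct {ι : Type*} [Fintype ι] (x : ι → ℂ) :
    ((‖WithLp.toLp 2 x‖ ^ 2 : ℝ) : ℂ) = star x ⬝ᵥ x := by
  rw [EuclideanSpace.norm_sq_eq]
  simp only [dotProduct, Pi.star_apply, Complex.ofReal_sum]
  refine Finset.sum_congr rfl fun i _ => ?_
  rw [mul_comm, RCLike.star_def, Complex.mul_conj, Complex.normSq_eq_norm_sq]

/-- The isometries of an orthogonal decomposition preserve the norm. -/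
lemma sum_norm_sq_conjTranspose_mulVec {ι κ : Type*} [Fintype ι] [DecidableEq ι] [Fintype κ]
    {n : κ → ℕ} {V : ∀ i, Matrix ι (Fin (n i)) ℂ} (hsum : ∑ i, V i * (V i)ᴴ = 1) (ξ : ι → ℂ) :
    ∑ i, ‖WithLp.toLp 2 ((V i)ᴴ *ᵥ ξ)‖ ^ 2 = ‖WithLp.toLp 2 ξ‖ ^ 2 := by
  apply Complex.ofReal_injective
  have h : ξ = ∑ i, (V i * (V i)ᴴ) *ᵥ ξ := by rw [← Matrix.sum_mulVec, hsum, Matrix.one_mulVec]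
  rw [ofReal_norm_sq_eq_dotProduct, Complex.ofReal_sum]
  conv_rhs => enter [2]; rw [h]
  rw [dotProduct_sum]
  refine Finset.sum_congr rfl fun i _ => ?_
  rw [ofReal_norm_sq_eq_dotProduct, Matrix.star_mulVec, Matrix.conjTranspose_conjTranspose,
    ← Matrix.dotProduct_mulVec, Matrix.mulVec_mulVec]

end Coefficients

/-! ### Trigonometric polynomials: products, conjugates and translates. -/

section TrigPoly

variable {G : Type*} [Group G] [TopologicalSpace G]

/-- The space `Trig(G)` of trigonometric polynomials. -/
def trigPoly (G : Type*) [Group G] [TopologicalSpace G] : Submodule ℂ C(G, ℂ) :=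
  ⨆ π : DualObject G, trigSpace π

lemma trigSpace_le_trigPoly (π : DualObject G) : trigSpace π ≤ trigPoly G :=
  le_iSup trigSpace π

lemma repCoeff_mem_trigPoly {ι : Type} [Fintype ι] [DecidableEq ι]
    (ρ : G →* Matrix.unitaryGroup ι ℂ) (hρ : Continuous ρ) (ξ η : ι → ℂ) :
    repCoeff ρ hρ ξ η ∈ trigPoly G := by
  obtain ⟨κ, _, σ, V, -, h2, h3⟩ := isCompletelyDecomposable ρ hρ
  rw [repCoeff_eq_sum hρ h2 h3]
  exact Submodule.sum_mem _ fun i _ => trigSpace_le_trigPoly _ (coeff_mem _ _ _)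

/-- The tensor product of unitary matrix representations. -/
def tensorRep {ι κ : Type*} [Fintype ι] [DecidableEq ι] [Fintype κ] [DecidableEq κ]
    (ρ : G →* Matrix.unitaryGroup ι ℂ) (σ : G →* Matrix.unitaryGroup κ ℂ) :
    G →* Matrix.unitaryGroup (ι × κ) ℂ where
  toFun s := ⟨(ρ s).1 ⊗ₖ (σ s).1, Matrix.kronecker_mem_unitary (ρ s).2 (σ s).2⟩
  map_one' := Subtype.ext (by simp)
  map_mul' s t := Subtype.ext (by simp [Matrix.mul_kronecker_mul])

lemma continuous_tensorRep {ι κ : Type*} [Fintype ι] [DecidableEq ι] [Fintype κ] [DecidableEq κ]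
    {ρ : G →* Matrix.unitaryGroup ι ℂ} {σ : G →* Matrix.unitaryGroup κ ℂ} (hρ : Continuous ρ)
    (hσ : Continuous σ) : Continuous (tensorRep ρ σ) := by
  refine Continuous.subtype_mk ?_ _
  have h1 : Continuous fun s => (ρ s).1 := continuous_subtype_val.comp hρ
  have h2 : Continuous fun s => (σ s).1 := continuous_subtype_val.comp hσ
  refine continuous_matrix fun p q => ?_
  change Continuous fun s => (ρ s).1 p.1 q.1 * (σ s).1 p.2 q.2
  exact (h1.matrix_elem _ _).mul (h2.matrix_elem _ _)

lemma dotProduct_mulVec_mul_dotProduct_mulVec {ι κ : Type*} [Fintype ι] [Fintype κ]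
    (A : Matrix ι ι ℂ) (B : Matrix κ κ ℂ) (ξ η : ι → ℂ) (ξ' η' : κ → ℂ) :
    (star η ⬝ᵥ (A *ᵥ ξ)) * (star η' ⬝ᵥ (B *ᵥ ξ')) =
      star (fun p : ι × κ => η p.1 * η' p.2) ⬝ᵥ
        ((A ⊗ₖ B) *ᵥ (fun p : ι × κ => ξ p.1 * ξ' p.2)) := by
  simp only [dotProduct, Matrix.mulVec, Matrix.kronecker_apply, Fintype.sum_prod_type,
    Finset.sum_mul_sum, Pi.star_apply, star_mul']
  refine Finset.sum_congr rfl fun i _ => Finset.sum_congr rfl fun k _ => ?_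
  rw [mul_mul_mul_comm, Finset.sum_mul_sum]
  congr 1
  exact Finset.sum_congr rfl fun j _ => Finset.sum_congr rfl fun l _ => by ring

lemma repCoeff_mul_repCoeff {ι κ : Type*} [Fintype ι] [DecidableEq ι] [Fintype κ] [DecidableEq κ]
    {ρ : G →* Matrix.unitaryGroup ι ℂ} {σ : G →* Matrix.unitaryGroup κ ℂ} (hρ : Continuous ρ)
    (hσ : Continuous σ) (ξ η : ι → ℂ) (ξ' η' : κ → ℂ) :
    repCoeff ρ hρ ξ η * repCoeff σ hσ ξ' η' = repCoeff (tensorRep ρ σ) (continuous_tensorRep hρ hσ)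
      (fun p => ξ p.1 * ξ' p.2) (fun p => η p.1 * η' p.2) := by
  ext s
  exact dotProduct_mulVec_mul_dotProduct_mulVec _ _ _ _ _ _

/-- The complex conjugate of a unitary matrix representation. -/
def conjRep {ι : Type*} [Fintype ι] [DecidableEq ι] (ρ : G →* Matrix.unitaryGroup ι ℂ) :
    G →* Matrix.unitaryGroup ι ℂ where
  toFun s := ⟨(ρ s).1.map (starRingEnd ℂ), by
    have h := Matrix.mem_unitaryGroup_iff.1 (ρ s).2
    rw [Matrix.mem_unitaryGroup_iff]
    have h2 := congrArg (fun M : Matrix ι ι ℂ => M.map (starRingEnd ℂ)) h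
    simpa [Matrix.map_mul, Matrix.star_eq_conjTranspose, Matrix.conjTranspose, Matrix.map_map,
      Function.comp_def, Matrix.transpose_map] using h2⟩
  map_one' := Subtype.ext (by simp)
  map_mul' s t := Subtype.ext (by simp [Matrix.map_mul])

lemma continuous_conjRep {ι : Type*} [Fintype ι] [DecidableEq ι]
    {ρ : G →* Matrix.unitaryGroup ι ℂ} (hρ : Continuous ρ) : Continuous (conjRep ρ) := by
  refine Continuous.subtype_mk ?_ _
  have h1 : Continuous fun s => (ρ s).1 := continuous_subtype_val.comp hρ
  exact h1.matrix_map Complex.continuous_conj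

lemma star_repCoeff {ι : Type*} [Fintype ι] [DecidableEq ι] {ρ : G →* Matrix.unitaryGroup ι ℂ}
    (hρ : Continuous ρ) (ξ η : ι → ℂ) :
    star (repCoeff ρ hρ ξ η) = repCoeff (conjRep ρ) (continuous_conjRep hρ) (star ξ) (star η) := by
  ext s
  simp [repCoeff_apply, dotProduct, Matrix.mulVec, conjRep]

/-- The generators are coefficients with arbitrary vectors ξ, η rather than matrix entries, because
tensor products, conjugation and translation act on such coefficients through the vectors. -/
lemma trigPoly_induction {p : C(G, ℂ) → Prop}
    (coeff : ∀ (π : DualObject G) (ξ η : Fin π.rep.dim → ℂ), p (π.rep.coeff ξ η))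
    (zero : p 0) (add : ∀ f g, p f → p g → p (f + g)) (smul : ∀ (c : ℂ) f, p f → p (c • f))
    {f : C(G, ℂ)} (hf : f ∈ trigPoly G) : p f := by
  induction hf using Submodule.iSup_induction' with
  | mem π x hx =>
    induction hx using Submodule.span_induction with
    | mem x hx =>
      obtain ⟨⟨k, l⟩, rfl⟩ := hx
      simp only [UnitaryIrrep.matrixCoeff_eq_coeff]
      exact coeff π _ _
    | zero => exact zero
    | add x y _ _ hx hy => exact add _ _ hx hy
    | smul c x _ hx => exact smul _ _ hx
  | zero => exact zero
  | add x y _ _ hx hy => exact add _ _ hx hy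

lemma mul_mem_trigPoly {f g : C(G, ℂ)} (hf : f ∈ trigPoly G) (hg : g ∈ trigPoly G) :
    f * g ∈ trigPoly G := by
  refine trigPoly_induction (p := fun f => f * g ∈ trigPoly G) (fun π ξ η => ?_) ?_
    (fun f g hf hg => ?_) (fun c f hf => ?_) hf
  · refine trigPoly_induction (p := fun g => π.rep.coeff ξ η * g ∈ trigPoly G) (fun σ ξ' η' => ?_) ?_
      (fun f g hf hg => ?_) (fun c f hf => ?_) hg
    · rw [repCoeff_mul_repCoeff]
      exact repCoeff_mem_trigPoly _ _ _ _
    · rw [mul_zero]; exact Submodule.zero_mem _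
    · rw [mul_add]; exact Submodule.add_mem _ hf hg
    · rw [mul_smul_comm]; exact Submodule.smul_mem _ c hf
  · rw [zero_mul]; exact Submodule.zero_mem _
  · rw [add_mul]; exact Submodule.add_mem _ hf hg
  · rw [smul_mul_assoc]; exact Submodule.smul_mem _ c hf

lemma star_mem_trigPoly {f : C(G, ℂ)} (hf : f ∈ trigPoly G) : star f ∈ trigPoly G := by
  refine trigPoly_induction (p := fun f => star f ∈ trigPoly G) (fun π ξ η => ?_) ?_
    (fun f g hf hg => ?_) (fun c f hf => ?_) hf
  · rw [star_repCoeff]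
    exact repCoeff_mem_trigPoly _ _ _ _
  · rw [star_zero]; exact Submodule.zero_mem _
  · rw [star_add]; exact Submodule.add_mem _ hf hg
  · rw [star_smul]; exact Submodule.smul_mem _ _ hf

/-- There is a class on which `G` acts trivially. -/
lemma exists_trivial_class (G : Type*) [Group G] [TopologicalSpace G] :
    ∃ π : DualObject G, ∀ s, π.rep.mat s = 1 := by
  -- The class is found as a summand of the one-dimensional trivial representation. A summand exists
  -- because the projections add up to 1 ≠ 0. That its dimension is 1 is never needed.
  obtain ⟨κ, _, σ, V, h1, h2, h3⟩ := isCompletelyDecomposable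
    (1 : G →* Matrix.unitaryGroup Unit ℂ) continuous_const
  have : Nonempty κ := by
    by_contra hcon
    rw [not_nonempty_iff] at hcon
    simp at h3
  obtain ⟨i⟩ := this
  refine ⟨σ i, fun s => ?_⟩
  have := congrArg (fun M => (V i)ᴴ * M) (h2 i s)
  simpa [← Matrix.mul_assoc, h1] using this.symm

lemma one_mem_trigSpace {π : DualObject G} (h : ∀ s, π.rep.mat s = 1) :
    (1 : C(G, ℂ)) ∈ trigSpace π := by
  have : (1 : C(G, ℂ)) = matrixCoeff π.rep ⟨0, π.rep.dim_pos⟩ ⟨0, π.rep.dim_pos⟩ := by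
    ext s
    simp [matrixCoeff_apply, h]
  rw [this]
  exact Submodule.subset_span ⟨(_, _), rfl⟩

lemma one_mem_trigPoly : (1 : C(G, ℂ)) ∈ trigPoly G :=
  let ⟨π, h⟩ := exists_trivial_class G
  trigSpace_le_trigPoly π (one_mem_trigSpace h)

/-- Right translation `(R_s f)(t) = f(ts)`. -/
def rightTranslate [IsTopologicalGroup G] (s : G) : C(G, ℂ) →ₐ[ℂ] C(G, ℂ) :=
  ContinuousMap.compRightAlgHom ℂ ℂ ⟨fun t => t * s, continuous_mul_const s⟩

lemma rightTranslate_apply [IsTopologicalGroup G] (s t : G) (f : C(G, ℂ)) :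
    rightTranslate s f t = f (t * s) := rfl

lemma rightTranslate_coeff [IsTopologicalGroup G] (π : UnitaryIrrep G) (ξ η : Fin π.dim → ℂ)
    (s : G) : rightTranslate s (π.coeff ξ η) = π.coeff (π.mat s *ᵥ ξ) η := by
  ext t
  simp [rightTranslate_apply, repCoeff_apply, UnitaryIrrep.mat]

lemma rightTranslate_mem [IsTopologicalGroup G] (s : G) {π : DualObject G} {f : C(G, ℂ)}
    (hf : f ∈ trigSpace π) : rightTranslate s f ∈ trigSpace π := by
  induction hf using Submodule.span_induction with
  | mem x hx =>
    obtain ⟨⟨k, l⟩, rfl⟩ := hx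
    simp only [UnitaryIrrep.matrixCoeff_eq_coeff]
    rw [rightTranslate_coeff]
    exact coeff_mem _ _ _
  | zero => simp
  | add x y _ _ hx hy => rw [map_add]; exact Submodule.add_mem _ hx hy
  | smul c x _ hx => rw [map_smul]; exact Submodule.smul_mem _ _ hx

end TrigPoly

/-! ### Rank-one matrices and the trace norm. -/

section TraceNormEstimates

variable {n : ℕ}

/-- The trace norm of a rank-one matrix. -/
lemma traceNorm_vecMulVec_le (ξ η : Fin n → ℂ) :
    traceNorm (Matrix.vecMulVec ξ (star η)) ≤ ‖WithLp.toLp 2 ξ‖ * ‖WithLp.toLp 2 η‖ := by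
  obtain ⟨v, w, hw, h⟩ := exists_traceNorm_eq (Matrix.vecMulVec ξ (star η))
  have happly : ∀ x : EuclideanSpace ℂ (Fin n),
      Matrix.toEuclideanLin (Matrix.vecMulVec ξ (star η)) x =
        ⟪WithLp.toLp 2 η, x⟫_ℂ • WithLp.toLp 2 ξ := fun x => by
    ext i
    simp [Matrix.toLpLin_apply, Matrix.vecMulVec_mulVec, PiLp.inner_apply, dotProduct,
      mul_comm]
  rw [h]
  -- Cauchy–Schwarz, with the Bessel inequality for w on the factor ξ and Parseval for v on the
  -- factor η.
  have h1 := Finset.sum_mul_sq_le_sq_mul_sq Finset.univ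
    (fun i => ‖⟪w i, WithLp.toLp 2 ξ⟫_ℂ‖) (fun i => ‖⟪WithLp.toLp 2 η, v i⟫_ℂ‖)
  rw [v.sum_sq_norm_inner_left] at h1
  have h2 := hw (WithLp.toLp 2 ξ)
  refine le_of_sq_le_sq ?_ (by positivity)
  rw [mul_pow]
  refine le_trans (le_of_eq ?_) (h1.trans (mul_le_mul_of_nonneg_right h2 (by positivity)))
  congr 1
  refine Finset.sum_congr rfl fun i _ => ?_
  rw [happly, inner_smul_right, norm_mul, mul_comm]

/-- A trace computed in an orthonormal basis adapted to the trace norm. -/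
lemma exists_trace_mul_eq_sum (A : Matrix (Fin n) (Fin n) ℂ) :
    ∃ x y : Fin n → Fin n → ℂ, (∀ B : Matrix (Fin n) (Fin n) ℂ,
      (B * A).trace = ∑ k, star (y k) ⬝ᵥ (B *ᵥ x k)) ∧
      ∑ k, ‖WithLp.toLp 2 (x k)‖ * ‖WithLp.toLp 2 (y k)‖ = traceNorm A := by
  obtain ⟨b, hb, -⟩ := exists_singular_basis A
  -- With b a singular basis of A, the vectors A b_k have the singular values as norms.
  refine ⟨fun k => A *ᵥ (b k).ofLp, fun k => (b k).ofLp, fun B => ?_, ?_⟩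
  · have h1 := LinearMap.trace_eq_sum_inner (Matrix.toEuclideanLin (B * A)) b
    have h2 : LinearMap.trace ℂ _ (Matrix.toEuclideanLin (B * A)) = (B * A).trace := by
      change LinearMap.trace ℂ _ (Matrix.toLpLin 2 2 (B * A)) = _
      rw [Matrix.toLpLin_eq_toLin, Matrix.trace_toLin_eq]
    rw [← h2, h1]
    refine Finset.sum_congr rfl fun k _ => ?_
    rw [Matrix.mulVec_mulVec]
    simp [Matrix.toLpLin_apply, PiLp.inner_apply, dotProduct, mul_comm]
  · refine Finset.sum_congr rfl fun k _ => ?_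
    have : ‖WithLp.toLp 2 (b k).ofLp‖ = 1 := b.orthonormal.1 k
    rw [this, mul_one, ← hb k]
    rfl

end TraceNormEstimates

lemma norm_toLp_prod {ι κ : Type*} [Fintype ι] [Fintype κ] (ξ : ι → ℂ) (ξ' : κ → ℂ) :
    ‖WithLp.toLp 2 (fun p : ι × κ => ξ p.1 * ξ' p.2)‖ = ‖WithLp.toLp 2 ξ‖ * ‖WithLp.toLp 2 ξ'‖ := by
  rw [← sq_eq_sq₀ (norm_nonneg _) (by positivity), mul_pow]
  simp only [EuclideanSpace.norm_sq_eq, Fintype.sum_prod_type, norm_mul, mul_pow,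
    Finset.sum_mul_sum]

lemma norm_toLp_mat_mulVec {G : Type*} [Group G] [TopologicalSpace G] (π : UnitaryIrrep G) (s : G)
    (ξ : Fin π.dim → ℂ) :
    ‖WithLp.toLp 2 (π.mat s *ᵥ ξ)‖ = ‖WithLp.toLp 2 ξ‖ := by
  rw [← sq_eq_sq₀ (norm_nonneg _) (norm_nonneg _)]
  apply Complex.ofReal_injective
  rw [ofReal_norm_sq_eq_dotProduct, ofReal_norm_sq_eq_dotProduct, Matrix.star_mulVec,
    ← Matrix.dotProduct_mulVec, Matrix.mulVec_mulVec, ← Matrix.star_eq_conjTranspose,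
    Matrix.mem_unitaryGroup_iff'.1 (π.mat_mem s), Matrix.one_mulVec]

/-- The algebra of trigonometric polynomials. -/
def trigAlgebra (G : Type*) [Group G] [TopologicalSpace G] : Subalgebra ℂ C(G, ℂ) :=
  (trigPoly G).toSubalgebra one_mem_trigPoly fun _ _ => mul_mem_trigPoly

/-! ### A_ω(G) as an ℓ¹-sum; norm estimates for products and translates. -/

section BeurlingFourier

variable {G : Type*} [Group G] [TopologicalSpace G]

/-- The inclusion of `Trig_π(G)` into the trigonometric polynomials. -/
def trigInclusion (π : DualObject G) : trigSpace π →ₗ[ℂ] trigAlgebra G where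
  toFun f := ⟨f, trigSpace_le_trigPoly π f.2⟩
  map_add' _ _ := rfl
  map_smul' _ _ := rfl

lemma trigAlgebra_linearMap_ext {F : Type*} [AddCommGroup F] [Module ℂ F]
    {L L' : trigAlgebra G →ₗ[ℂ] F}
    (h : ∀ π f, L (trigInclusion π f) = L' (trigInclusion π f)) : L = L' := by
  ext ⟨f, hf⟩
  -- Membership goes into the predicate because the induction runs over bare functions.
  suffices ∃ hf : f ∈ trigAlgebra G, L ⟨f, hf⟩ = L' ⟨f, hf⟩ from this.2
  refine trigPoly_induction (p := fun f => ∃ hf : f ∈ trigAlgebra G, L ⟨f, hf⟩ = L' ⟨f, hf⟩)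
    (fun π ξ η => ?_) ?_ (fun f g hf hg => ?_) (fun c f hf => ?_) hf
  · exact ⟨_, h π ⟨_, coeff_mem π ξ η⟩⟩
  · exact ⟨Subalgebra.zero_mem _, (map_zero L).trans (map_zero L').symm⟩
  · obtain ⟨hf, h1⟩ := hf
    obtain ⟨hg, h2⟩ := hg
    refine ⟨Subalgebra.add_mem _ hf hg, ?_⟩
    exact (map_add L ⟨f, hf⟩ ⟨g, hg⟩).trans
      ((congrArg₂ (· + ·) h1 h2).trans (map_add L' ⟨f, hf⟩ ⟨g, hg⟩).symm)
  · obtain ⟨hf, h1⟩ := hf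
    refine ⟨Subalgebra.smul_mem _ hf c, ?_⟩
    exact (map_smul L c ⟨f, hf⟩).trans
      ((congrArg (c • ·) h1).trans (map_smul L' c ⟨f, hf⟩).symm)

variable [IsTopologicalGroup G] [CompactSpace G] [MeasurableSpace G] [BorelSpace G]

lemma finite_support_isotypicPart {f : C(G, ℂ)} (hf : f ∈ trigPoly G) :
    (Function.support fun π => (isotypicPart π f : C(G, ℂ))).Finite := by
  refine trigPoly_induction (p := fun f =>
    (Function.support fun π => (isotypicPart π f : C(G, ℂ))).Finite)
    (fun π ξ η => ?_) ?_ (fun f g hf hg => ?_) (fun c f hf => ?_) hf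
  · refine (Set.finite_singleton π).subset fun σ hσ => ?_
    by_contra hne
    exact hσ (congrArg Subtype.val (isotypicPart_of_mem_of_ne (Ne.symm hne) (coeff_mem π ξ η)))
  · simp
  · refine (hf.union hg).subset ?_
    simp only [map_add, Submodule.coe_add]
    exact Function.support_add _ _
  · refine hf.subset fun σ hσ h0 => hσ ?_
    have h1 : (isotypicPart σ f : C(G, ℂ)) = 0 := h0
    change (isotypicPart σ (c • f) : C(G, ℂ)) = 0
    rw [map_smul, Submodule.coe_smul, h1, smul_zero]

lemma weightedTerm_eq_zero {ω : DualWeight G} {u : FormalTrigSeries G} {π : DualObject G}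
    (h : u π = 0) : weightedTerm ω u π = 0 := by
  simp [weightedTerm, h, traceNorm_zero]

namespace BeurlingFourier

variable {ω : DualWeight G}

/-- The component map onto `Trig_π(G)`. -/
def proj (π : DualObject G) : BeurlingFourier ω →ₗ[ℂ] trigSpace π where
  toFun u := u.1 π
  map_add' _ _ := rfl
  map_smul' _ _ := rfl

lemma ext_component {u v : BeurlingFourier ω} (h : ∀ π, proj π u = proj π v) : u = v :=
  Subtype.ext (funext h)

lemma norm_eq_tsum (u : BeurlingFourier ω) : ‖u‖ = ∑' π, weightedTerm ω u.1 π := rfl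

variable (ω) in
/-- The embedding of the trigonometric polynomials into `A_ω(G)`. -/
def ofTrig : trigAlgebra G →ₗ[ℂ] BeurlingFourier ω where
  toFun f := ⟨fun π => isotypicPart π f.1, by
    refine summable_of_hasFiniteSupport ((finite_support_isotypicPart f.2).subset fun π h h0 => h ?_)
    exact weightedTerm_eq_zero (Subtype.ext h0)⟩
  map_add' f g := ext_component fun π => map_add (isotypicPart π) f.1 g.1
  map_smul' c f := ext_component fun π => map_smul (isotypicPart π) c f.1

lemma ofTrig_apply (f : trigAlgebra G) (π : DualObject G) :
    proj π (ofTrig ω f) = isotypicPart π f.1 := rfl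

variable (ω) in
/-- The embedding of `Trig_π(G)` into `A_ω(G)`. -/
def single (π : DualObject G) : trigSpace π →ₗ[ℂ] BeurlingFourier ω :=
  (ofTrig ω).comp (trigInclusion π)

lemma ofTrig_trigInclusion (π : DualObject G) (f : trigSpace π) :
    ofTrig ω (trigInclusion π f) = single ω π f := rfl

@[simp]
lemma single_same (π : DualObject G) (f : trigSpace π) : proj π (single ω π f) = f :=
  Subtype.ext (isotypicPart_of_mem f.2)

lemma single_of_ne {π σ : DualObject G} (h : π ≠ σ) (f : trigSpace π) :
    proj σ (single ω π f) = 0 :=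
  isotypicPart_of_mem_of_ne h f.2

lemma norm_single (π : DualObject G) (f : trigSpace π) :
    ‖single ω π f‖ = traceNorm (fourierOp π (f : C(G, ℂ))) * π.rep.dim * ω.toFun π := by
  rw [norm_eq_tsum, tsum_eq_single π fun σ h => weightedTerm_eq_zero (single_of_ne (ω := ω) h.symm f),
    weightedTerm]
  congr 4
  exact congrArg Subtype.val (single_same (ω := ω) π f)

lemma norm_single_proj (u : BeurlingFourier ω) (π : DualObject G) :
    ‖single ω π (proj π u)‖ = weightedTerm ω u.1 π := norm_single π _

lemma summable_norm_single (u : BeurlingFourier ω) :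
    Summable fun π => ‖single ω π (proj π u)‖ := by
  simp only [norm_single_proj]
  exact u.2

lemma norm_eq_tsum_norm_single (u : BeurlingFourier ω) :
    ‖u‖ = ∑' π, ‖single ω π (proj π u)‖ := by
  rw [norm_eq_tsum]
  exact tsum_congr fun π => (norm_single_proj u π).symm

/-- Every element of `A_ω(G)` is the sum of its components. -/
lemma hasSum_single (u : BeurlingFourier ω) : HasSum (fun π => single ω π (proj π u)) u := by
  classical
  -- The error of a finite partial sum is the tail of the series defining the norm, and such tails
  -- tend to 0.
  have key : ∀ S : Finset (DualObject G), ‖∑ π ∈ S, single ω π (proj π u) - u‖ =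
      ∑' π : {π // π ∉ S}, weightedTerm ω u.1 π := by
    intro S
    rw [norm_sub_rev, norm_eq_tsum]
    have : ∀ π, proj π (u - ∑ σ ∈ S, single ω σ (proj σ u)) = if π ∈ S then 0 else proj π u := by
      intro π
      rw [map_sub, map_sum]
      have h2 : ∀ σ, proj π (single ω σ (proj σ u)) = if π = σ then u.1 π else 0 := fun σ => by
        split_ifs with h
        · subst h; exact single_same _ _
        · exact single_of_ne (Ne.symm h) _
      simp only [h2, Finset.sum_ite_eq]
      split_ifs with h
      · exact sub_self _
      · exact sub_zero _
    rw [← Function.Injective.tsum_eq (g := ((↑) : {π // π ∉ S} → DualObject G))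
      Subtype.val_injective]
    · refine tsum_congr fun π => ?_
      have h := this π
      rw [if_neg π.2] at h
      change (u - ∑ σ ∈ S, single ω σ (proj σ u)).1 π = u.1 π at h
      simp only [weightedTerm, h]
    · intro π hπ
      by_contra hS
      have hS' : π ∈ S := by simpa using hS
      exact hπ (weightedTerm_eq_zero ((this π).trans (if_pos hS')))
  rw [HasSum, SummationFilter.unconditional_filter, tendsto_iff_norm_sub_tendsto_zero]
  simp only [key]
  exact tendsto_tsum_compl_atTop_zero _

/-- Taking components is a surjective isometry onto the ℓ¹-sum of the images of the Trig_π(G), which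
are finite-dimensional and hence complete. -/
instance : CompleteSpace (BeurlingFourier ω) := by
  let E : DualObject G → Submodule ℂ (BeurlingFourier ω) := fun π => LinearMap.range (single ω π)
  have : ∀ π : DualObject G, FiniteDimensional ℂ (trigSpace π) := fun π =>
    FiniteDimensional.span_of_finite ℂ (Set.finite_range _)
  have hE : ∀ π, CompleteSpace (E π) := fun π => FiniteDimensional.complete ℂ (E π)
  let Φ : BeurlingFourier ω → lp (fun π => E π) 1 := fun u =>
    ⟨fun π => ⟨single ω π (proj π u), _, rfl⟩, memℓp_gen (by
      simpa using summable_norm_single u)⟩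
  have hΦ : Isometry Φ := by
    refine Isometry.of_dist_eq fun u v => ?_
    rw [dist_eq_norm, dist_eq_norm, lp.norm_eq_tsum_rpow (by simp), norm_eq_tsum_norm_single]
    simp only [ENNReal.toReal_one, Real.rpow_one, div_one]
    refine tsum_congr fun π => ?_
    change ‖single ω π (proj π u) - single ω π (proj π v)‖ = ‖single ω π (proj π (u - v))‖
    rw [← map_sub]
    rfl
  have hsurj : Function.Surjective Φ := by
    intro y
    choose f hf using fun π => (y.1 π).2
    have hs : Summable fun π => ‖single ω π (f π)‖ := by
      have := (lp.memℓp y).summable (by simp)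
      simp only [ENNReal.toReal_one, Real.rpow_one] at this
      refine this.congr fun π => ?_
      rw [hf]
      rfl
    refine ⟨⟨f, hs.congr fun π => norm_single π (f π)⟩, ?_⟩
    exact Subtype.ext (funext fun π => Subtype.ext (hf π))
  exact (hΦ.isUniformInducing.completeSpace_congr hsurj).2 inferInstance

/-- Continuous linear maps on `A_ω(G)` are determined by their values on the spaces
`Trig_π(G)`. -/
lemma clm_ext {F : Type*} [NormedAddCommGroup F] [NormedSpace ℂ F]
    {L L' : BeurlingFourier ω →L[ℂ] F}
    (h : ∀ π f, L (single ω π f) = L' (single ω π f)) : L = L' := by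
  ext u
  have h1 := (hasSum_single u).mapL L
  have h2 := (hasSum_single u).mapL L'
  simp only [h] at h1
  exact h1.unique h2

/-- The continuous linear map with prescribed uniformly bounded restrictions to the spaces
`Trig_π(G)`. -/
def lift {F : Type*} [NormedAddCommGroup F] [NormedSpace ℂ F] [CompleteSpace F]
    (T : ∀ π : DualObject G, trigSpace π →ₗ[ℂ] F) (C : ℝ)
    (hT : ∀ π f, ‖T π f‖ ≤ C * ‖single ω π f‖) : BeurlingFourier ω →L[ℂ] F :=
  have hs : ∀ u : BeurlingFourier ω, Summable fun π => ‖T π (proj π u)‖ := fun u =>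
    Summable.of_nonneg_of_le (fun _ => norm_nonneg _) (fun π => hT π _)
      ((summable_norm_single u).mul_left C)
  LinearMap.mkContinuous
    { toFun := fun u => ∑' π, T π (proj π u)
      map_add' := fun u v => by
        simp only [map_add]
        exact (hs u).of_norm.tsum_add (hs v).of_norm
      map_smul' := fun c u => by
        simp only [map_smul, RingHom.id_apply]
        exact (hs u).of_norm.tsum_const_smul c } C fun u => by
    refine (norm_tsum_le_tsum_norm (hs u)).trans ?_
    rw [norm_eq_tsum_norm_single, ← tsum_mul_left]
    exact (hs u).tsum_le_tsum (fun π => hT π _) ((summable_norm_single u).mul_left C)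

section lift

variable {F : Type*} [NormedAddCommGroup F] [NormedSpace ℂ F] [CompleteSpace F]
    (T : ∀ π : DualObject G, trigSpace π →ₗ[ℂ] F) (C : ℝ)
    (hT : ∀ π f, ‖T π f‖ ≤ C * ‖single ω π f‖)

lemma lift_single (π : DualObject G) (f : trigSpace π) : lift T C hT (single ω π f) = T π f := by
  change ∑' σ, T σ (proj σ (single ω π f)) = _
  rw [tsum_eq_single π fun σ h => by rw [single_of_ne h.symm, map_zero], single_same]

lemma norm_lift_le (hC : 0 ≤ C) : ‖lift T C hT‖ ≤ C := by
  unfold lift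
  exact LinearMap.mkContinuous_norm_le _ hC _

end lift

lemma fourierOp_coeff (π : DualObject G) (ξ η : Fin π.rep.dim → ℂ) :
    fourierOp π (π.rep.coeff ξ η) = (π.rep.dim : ℂ)⁻¹ • Matrix.vecMulVec ξ (star η) := by
  rw [UnitaryIrrep.coeff_eq_sum]
  simp only [map_sum, map_smul, fourierOp_matrixCoeff_self]
  simp only [smul_comm _ (π.rep.dim : ℂ)⁻¹, ← Finset.smul_sum]
  congr 1
  ext i j
  simp [Matrix.sum_apply, Matrix.single_apply, Matrix.vecMulVec_apply, ite_and, mul_comm]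

/-- The factor d_π in the norm cancels the d_π⁻¹ of Schur orthogonality, leaving the trace norm of a
rank-one matrix. The bound is thus free of the dimension. -/
lemma norm_single_coeff_le (π : DualObject G) (ξ η : Fin π.rep.dim → ℂ) :
    ‖single ω π ⟨π.rep.coeff ξ η, coeff_mem π ξ η⟩‖ ≤
      ω.toFun π * (‖WithLp.toLp 2 ξ‖ * ‖WithLp.toLp 2 η‖) := by
  have hd : (π.rep.dim : ℝ) ≠ 0 := Nat.cast_ne_zero.2 π.rep.dim_pos.ne'
  rw [norm_single, mul_comm]
  refine mul_le_mul_of_nonneg_left ?_ (ω.pos π).le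
  rw [fourierOp_coeff, traceNorm_smul, norm_inv, Complex.norm_natCast, mul_comm, ← mul_assoc,
    mul_inv_cancel₀ hd, one_mul]
  exact traceNorm_vecMulVec_le ξ η

/-- An element of `Trig_π(G)` is a sum of coefficient functions realizing its norm. -/
lemma exists_eq_sum_coeff {π : DualObject G} (f : trigSpace π) :
    ∃ x y : Fin π.rep.dim → Fin π.rep.dim → ℂ, (f : C(G, ℂ)) = ∑ k, π.rep.coeff (x k) (y k) ∧
      ω.toFun π * ∑ k, ‖WithLp.toLp 2 (x k)‖ * ‖WithLp.toLp 2 (y k)‖ = ‖single ω π f‖ := by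
  obtain ⟨x, y, h1, h2⟩ := exists_trace_mul_eq_sum (fourierOp π (f : C(G, ℂ)))
  -- The factor d_π is the one in the inversion formula f(s) = d_π tr(π(s) f̂(π)).
  refine ⟨fun k => (π.rep.dim : ℂ) • x k, y, ?_, ?_⟩
  · conv_lhs => rw [← isotypicPart_of_mem f.2, isotypicPart_eq]
    ext s
    have := h1 (π.rep.mat s)
    rw [Matrix.trace, Finset.sum_congr rfl fun i _ => by
      rw [Matrix.diag_apply, Matrix.mul_apply], Finset.sum_comm] at this
    simp only [ContinuousMap.smul_apply, ContinuousMap.sum_apply, matrixCoeff_apply, smul_eq_mul,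
      repCoeff_apply, Matrix.mulVec_smul, dotProduct_smul, ← Finset.mul_sum]
    congr 1
    refine Eq.trans ?_ this
    exact Finset.sum_congr rfl fun i _ => Finset.sum_congr rfl fun j _ => mul_comm _ _
  · simp only [WithLp.toLp_smul, norm_smul, Complex.norm_natCast, mul_assoc, ← Finset.mul_sum]
    rw [h2, norm_single]
    ring

/-- The norm of a coefficient function of a representation all of whose irreducible summands have
weight at most `C`. -/
lemma norm_ofTrig_repCoeff_le {ι κ : Type*} [Fintype ι] [DecidableEq ι] [Fintype κ]
    {ρ : G →* Matrix.unitaryGroup ι ℂ} (hρ : Continuous ρ) {σ : κ → DualObject G}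
    {V : ∀ i, Matrix ι (Fin (σ i).rep.dim) ℂ}
    (h : ∀ i s, (ρ s).1 * V i = V i * (σ i).rep.mat s)
    (hsum : ∑ i, V i * (V i)ᴴ = 1) {C : ℝ} (hC : 0 ≤ C) (hω : ∀ i, ω.toFun (σ i) ≤ C)
    (ξ η : ι → ℂ) (hmem : repCoeff ρ hρ ξ η ∈ trigAlgebra G) :
    ‖ofTrig ω ⟨repCoeff ρ hρ ξ η, hmem⟩‖ ≤ C * (‖WithLp.toLp 2 ξ‖ * ‖WithLp.toLp 2 η‖) := by
  have heq : (⟨repCoeff ρ hρ ξ η, hmem⟩ : trigAlgebra G) = ∑ i, trigInclusion (σ i)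
      ⟨(σ i).rep.coeff ((V i)ᴴ *ᵥ ξ) ((V i)ᴴ *ᵥ η), coeff_mem _ _ _⟩ := by
    apply Subtype.ext
    rw [AddSubmonoidClass.coe_finsetSum]
    exact repCoeff_eq_sum hρ h hsum ξ η
  rw [heq, map_sum]
  -- Cauchy–Schwarz over the summands: the squared norms of the pieces of ξ and of η add up to ‖ξ‖²
  -- and ‖η‖², so neither the number of summands nor their multiplicities enter the bound.
  have hcs := Finset.sum_mul_sq_le_sq_mul_sq Finset.univ
    (fun i => ‖WithLp.toLp 2 ((V i)ᴴ *ᵥ ξ)‖) (fun i => ‖WithLp.toLp 2 ((V i)ᴴ *ᵥ η)‖)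
  rw [sum_norm_sq_conjTranspose_mulVec hsum, sum_norm_sq_conjTranspose_mulVec hsum, ← mul_pow]
    at hcs
  refine (norm_sum_le _ _).trans (le_trans ?_ (mul_le_mul_of_nonneg_left
    (le_of_sq_le_sq hcs (by positivity)) hC))
  rw [Finset.mul_sum]
  refine Finset.sum_le_sum fun i _ => (norm_single_coeff_le _ _ _).trans ?_
  exact mul_le_mul_of_nonneg_right (hω i) (by positivity)

/-- The product is a coefficient of π ⊗ π' at product vectors. The weight inequality enters here, to
bound the weights of the irreducible summands. -/
lemma norm_ofTrig_coeff_mul_coeff_le (π π' : DualObject G) (ξ η : Fin π.rep.dim → ℂ)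
    (ξ' η' : Fin π'.rep.dim → ℂ) :
    ‖ofTrig ω (trigInclusion π ⟨_, coeff_mem π ξ η⟩ * trigInclusion π' ⟨_, coeff_mem π' ξ' η'⟩)‖ ≤
      (ω.toFun π * (‖WithLp.toLp 2 ξ‖ * ‖WithLp.toLp 2 η‖)) *
      (ω.toFun π' * (‖WithLp.toLp 2 ξ'‖ * ‖WithLp.toLp 2 η'‖)) := by
  have hc := continuous_tensorRep π.rep.continuous_hom π'.rep.continuous_hom
  obtain ⟨κ, _, σ, V, h1, h2, h3⟩ := isCompletelyDecomposable _ hc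
  have hω : ∀ i, ω.toFun (σ i) ≤ ω.toFun π * ω.toFun π' := fun i =>
    ω.le_mul _ _ _ ⟨V i, h1 i, h2 i⟩
  have hmul : trigInclusion π ⟨_, coeff_mem π ξ η⟩ * trigInclusion π' ⟨_, coeff_mem π' ξ' η'⟩ =
      ⟨repCoeff _ hc (fun p => ξ p.1 * ξ' p.2) (fun p => η p.1 * η' p.2),
        repCoeff_mem_trigPoly _ _ _ _⟩ :=
    Subtype.ext (repCoeff_mul_repCoeff π.rep.continuous_hom π'.rep.continuous_hom _ _ _ _)
  rw [hmul]
  refine (norm_ofTrig_repCoeff_le hc h2 h3 (mul_nonneg (ω.pos π).le (ω.pos π').le) hω _ _ _).trans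
    (le_of_eq ?_)
  rw [norm_toLp_prod, norm_toLp_prod]
  ring

/-- Submultiplicativity of the norm of `A_ω(G)` on the spaces `Trig_π(G)`. -/
lemma norm_ofTrig_mul_le (π π' : DualObject G) (f : trigSpace π) (g : trigSpace π') :
    ‖ofTrig ω (trigInclusion π f * trigInclusion π' g)‖ ≤ ‖single ω π f‖ * ‖single ω π' g‖ := by
  obtain ⟨x, y, h1, h2⟩ := exists_eq_sum_coeff (ω := ω) f
  obtain ⟨x', y', h1', h2'⟩ := exists_eq_sum_coeff (ω := ω) g
  have hf : trigInclusion π f = ∑ k, trigInclusion π ⟨_, coeff_mem π (x k) (y k)⟩ := by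
    apply Subtype.ext
    rw [AddSubmonoidClass.coe_finsetSum]
    exact h1
  have hg : trigInclusion π' g = ∑ k, trigInclusion π' ⟨_, coeff_mem π' (x' k) (y' k)⟩ := by
    apply Subtype.ext
    rw [AddSubmonoidClass.coe_finsetSum]
    exact h1'
  rw [← h2, ← h2', hf, hg, Finset.sum_mul_sum, map_sum, Finset.mul_sum, Finset.mul_sum,
    Finset.sum_mul_sum]
  refine (norm_sum_le _ _).trans (Finset.sum_le_sum fun k _ => ?_)
  rw [map_sum]
  exact (norm_sum_le _ _).trans (Finset.sum_le_sum fun l _ =>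
    norm_ofTrig_coeff_mul_coeff_le _ _ _ _ _ _)

/-- Right translation on `Trig_π(G)`. -/
def trigTranslate (s : G) (π : DualObject G) : trigSpace π →ₗ[ℂ] trigSpace π :=
  (rightTranslate s).toLinearMap.restrict fun _ => rightTranslate_mem s

/-- Translation by s replaces each x_k in a norm-realizing expansion of f by π(s)x_k, of the same
norm. -/
lemma norm_single_trigTranslate_le (s : G) (π : DualObject G) (f : trigSpace π) :
    ‖single ω π (trigTranslate s π f)‖ ≤ ‖single ω π f‖ := by
  obtain ⟨x, y, h1, h2⟩ := exists_eq_sum_coeff (ω := ω) f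
  have hf : trigTranslate s π f = ∑ k, ⟨_, coeff_mem π (π.rep.mat s *ᵥ x k) (y k)⟩ := by
    apply Subtype.ext
    rw [AddSubmonoidClass.coe_finsetSum]
    change rightTranslate s (f : C(G, ℂ)) = _
    rw [h1, map_sum]
    exact Finset.sum_congr rfl fun k _ => rightTranslate_coeff _ _ _ _
  rw [hf, map_sum, ← h2, Finset.mul_sum]
  refine (norm_sum_le _ _).trans (Finset.sum_le_sum fun k _ => ?_)
  refine (norm_single_coeff_le _ _ _).trans (le_of_eq ?_)
  rw [norm_toLp_mat_mulVec]

end BeurlingFourier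

end BeurlingFourier

/-! ### Construction of the product and of the translations. -/

section BeurlingFourier

lemma rightTranslate_mem_trigAlgebra {G : Type*} [Group G] [TopologicalSpace G]
    [IsTopologicalGroup G] (s : G) {f : C(G, ℂ)} (hf : f ∈ trigAlgebra G) :
    rightTranslate s f ∈ trigAlgebra G := by
  refine trigPoly_induction (p := fun f => rightTranslate s f ∈ trigPoly G)
    (fun π ξ η => ?_) ?_ (fun f g hf hg => ?_) (fun c f hf => ?_) hf
  · exact trigSpace_le_trigPoly π (rightTranslate_mem s (coeff_mem π ξ η))
  · rw [map_zero]; exact Submodule.zero_mem _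
  · rw [map_add]; exact Submodule.add_mem _ hf hg
  · rw [map_smul]; exact Submodule.smul_mem _ _ hf

variable {G : Type*} [Group G] [TopologicalSpace G] [IsTopologicalGroup G] [CompactSpace G]
  [MeasurableSpace G] [BorelSpace G]

namespace BeurlingFourier

variable {ω : DualWeight G}

lemma isTrigPoly_ofTrig (f : trigAlgebra G) : (ofTrig ω f).IsTrigPoly :=
  finite_support_isotypicPart f.2

lemma polyFun_ofTrig (f : trigAlgebra G) : (ofTrig ω f).polyFun = f := by
  change ∑ᶠ π, (isotypicPart π f.1 : C(G, ℂ)) = f.1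
  refine (trigPoly_induction (p := fun f => f ∈ trigPoly G ∧
    ∑ᶠ π, (isotypicPart π f : C(G, ℂ)) = f) (fun π ξ η => ?_) ?_ (fun f g hf hg => ?_)
    (fun c f hf => ?_) f.2).2
  · refine ⟨trigSpace_le_trigPoly π (coeff_mem π ξ η), ?_⟩
    rw [finsum_eq_single _ π fun σ h => congrArg Subtype.val
      (isotypicPart_of_mem_of_ne h.symm (coeff_mem π ξ η))]
    exact isotypicPart_of_mem (coeff_mem π ξ η)
  · simp
  · refine ⟨Submodule.add_mem _ hf.1 hg.1, ?_⟩
    simp only [map_add, Submodule.coe_add]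
    rw [finsum_add_distrib (finite_support_isotypicPart hf.1) (finite_support_isotypicPart hg.1),
      hf.2, hg.2]
  · refine ⟨Submodule.smul_mem _ _ hf.1, ?_⟩
    simp only [map_smul, Submodule.coe_smul]
    rw [← smul_finsum' _ (finite_support_isotypicPart hf.1), hf.2]

lemma IsTrigPoly.polyFun_mem {u : BeurlingFourier ω} (hu : u.IsTrigPoly) :
    u.polyFun ∈ trigAlgebra G := by
  rw [polyFun, finsum_eq_sum _ hu]
  exact Submodule.sum_mem (trigPoly G) fun π _ => trigSpace_le_trigPoly π (u.1 π).2

/-- With `polyFun_ofTrig`, this identifies the finitely supported elements with the functions in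
Trig(G). -/
lemma IsTrigPoly.eq_ofTrig {u : BeurlingFourier ω} (hu : u.IsTrigPoly) :
    u = ofTrig ω ⟨u.polyFun, hu.polyFun_mem⟩ := by
  refine ext_component fun π => ?_
  rw [ofTrig_apply]
  change _ = isotypicPart π (∑ᶠ σ, u.component σ)
  rw [finsum_eq_sum _ hu, map_sum, ← finsum_eq_sum_of_support_subset,
    finsum_eq_single (fun σ => isotypicPart π (u.component σ)) π fun σ h =>
      isotypicPart_of_mem_of_ne h (u.1 σ).2]
  · exact (Subtype.ext (isotypicPart_of_mem (u.1 π).2)).symm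
  · intro σ hσ
    refine (Set.Finite.mem_toFinset (hs := hu)).2 fun h0 => ?_
    exact hσ (by change isotypicPart π (u.component σ) = 0; rw [h0, map_zero])

/-- Multiplication by a trigonometric polynomial in `Trig_π(G)`. -/
def mulLeftCLM (π : DualObject G) (f : trigSpace π) :
    BeurlingFourier ω →L[ℂ] BeurlingFourier ω :=
  lift (fun σ => (ofTrig ω).comp
    ((LinearMap.mulLeft ℂ (trigInclusion π f)).comp (trigInclusion σ)))
    ‖single ω π f‖ fun σ g => norm_ofTrig_mul_le π σ f g

lemma mulLeftCLM_single (π σ : DualObject G) (f : trigSpace π) (g : trigSpace σ) :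
    mulLeftCLM π f (single ω σ g) = ofTrig ω (trigInclusion π f * trigInclusion σ g) :=
  lift_single _ _ (fun σ g => norm_ofTrig_mul_le π σ f g) _ _

lemma norm_mulLeftCLM_le (π : DualObject G) (f : trigSpace π) :
    ‖mulLeftCLM (ω := ω) π f‖ ≤ ‖single ω π f‖ :=
  norm_lift_le _ _ (fun σ g => norm_ofTrig_mul_le π σ f g) (norm_nonneg _)

variable (ω) in
/-- The multiplication operators by elements of `Trig_π(G)`. -/
def mulTrig (π : DualObject G) :
    trigSpace π →ₗ[ℂ] BeurlingFourier ω →L[ℂ] BeurlingFourier ω where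
  toFun := mulLeftCLM π
  map_add' f g := clm_ext fun σ h => by
    simp [mulLeftCLM_single, add_mul]
  map_smul' c f := clm_ext fun σ h => by
    simp [mulLeftCLM_single]

lemma norm_mulTrig_le (π : DualObject G) (f : trigSpace π) :
    ‖mulTrig ω π f‖ ≤ 1 * ‖single ω π f‖ := by
  rw [one_mul]
  exact norm_mulLeftCLM_le π f

variable (ω) in
/-- The product of `A_ω(G)` as a continuous bilinear map. -/
def mulCLM : BeurlingFourier ω →L[ℂ] BeurlingFourier ω →L[ℂ] BeurlingFourier ω :=
  lift (mulTrig ω) 1 norm_mulTrig_le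

lemma mulCLM_single (π σ : DualObject G) (f : trigSpace π) (g : trigSpace σ) :
    mulCLM ω (single ω π f) (single ω σ g) =
      ofTrig ω (trigInclusion π f * trigInclusion σ g) := by
  rw [mulCLM, lift_single]
  exact mulLeftCLM_single π σ f g

lemma mulCLM_ofTrig (f g : trigAlgebra G) :
    mulCLM ω (ofTrig ω f) (ofTrig ω g) = ofTrig ω (f * g) := by
  have h : ((mulCLM ω).toLinearMap₁₂.comp (ofTrig ω)).compl₂ (ofTrig ω) =
      (LinearMap.mul ℂ (trigAlgebra G)).compr₂ (ofTrig ω) :=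
    trigAlgebra_linearMap_ext fun π f => trigAlgebra_linearMap_ext fun σ g =>
      mulCLM_single π σ f g
  exact LinearMap.congr_fun₂ h f g

lemma norm_mulCLM_le (u v : BeurlingFourier ω) : ‖mulCLM ω u v‖ ≤ ‖u‖ * ‖v‖ :=
  ((mulCLM ω).le_opNorm₂ u v).trans (by
    have : ‖mulCLM ω‖ ≤ 1 := norm_lift_le _ _ norm_mulTrig_le zero_le_one
    rw [mul_assoc]
    exact mul_le_of_le_one_left (by positivity) this)

lemma mulCLM_comm (u v : BeurlingFourier ω) : mulCLM ω u v = mulCLM ω v u := by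
  have h : mulCLM ω = (mulCLM ω).flip := clm_ext fun π f => clm_ext fun σ g => by
    rw [ContinuousLinearMap.flip_apply, mulCLM_single, mulCLM_single, mul_comm]
  conv_lhs => rw [h]
  rfl

/-- Associativity holds on trigonometric polynomials and is extended by continuity one variable at a
time: `h1` frees w, `h2` frees v, `h3` frees u. -/
lemma mulCLM_assoc (u v w : BeurlingFourier ω) :
    mulCLM ω (mulCLM ω u v) w = mulCLM ω u (mulCLM ω v w) := by
  have h1 : ∀ f g, (mulCLM ω (mulCLM ω (ofTrig ω f) (ofTrig ω g))) =
      (mulCLM ω (ofTrig ω f)).comp (mulCLM ω (ofTrig ω g)) := fun f g => clm_ext fun σ h => by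
    rw [ContinuousLinearMap.comp_apply, ← ofTrig_trigInclusion]
    simp only [mulCLM_ofTrig, mul_assoc]
  have h2 : ∀ f w, (mulCLM ω).flip w ∘L mulCLM ω (ofTrig ω f) =
      mulCLM ω (ofTrig ω f) ∘L (mulCLM ω).flip w := fun f w => clm_ext fun σ g => by
    exact congrArg (fun L : BeurlingFourier ω →L[ℂ] BeurlingFourier ω => L w)
      (h1 f (trigInclusion σ g))
  have h3 : (mulCLM ω).flip w ∘L (mulCLM ω).flip v = (mulCLM ω).flip (mulCLM ω v w) :=
    clm_ext fun σ f => by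
      exact congrArg (fun L : BeurlingFourier ω →L[ℂ] BeurlingFourier ω => L v)
        (h2 (trigInclusion σ f) w)
  exact congrArg (fun L : BeurlingFourier ω →L[ℂ] BeurlingFourier ω => L u) h3

lemma ofTrig_one_mulCLM (u : BeurlingFourier ω) : mulCLM ω (ofTrig ω 1) u = u := by
  have h : mulCLM ω (ofTrig ω 1) = ContinuousLinearMap.id ℂ _ := clm_ext fun π f => by
    rw [← ofTrig_trigInclusion, mulCLM_ofTrig, one_mul, ContinuousLinearMap.id_apply]
  rw [h, ContinuousLinearMap.id_apply]

variable (ω) in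
/-- The product of the Beurling–Fourier algebra. -/
def product : BeurlingFourierProduct ω where
  mul := (mulCLM ω).toLinearMap₁₂
  one := ofTrig ω 1
  isTrigPoly_mul u v hu hv := by
    rw [hu.eq_ofTrig, hv.eq_ofTrig]
    change (mulCLM ω _ _).IsTrigPoly
    rw [mulCLM_ofTrig]
    exact isTrigPoly_ofTrig _
  polyFun_mul u v hu hv := by
    conv_lhs => rw [hu.eq_ofTrig, hv.eq_ofTrig]
    change (mulCLM ω _ _).polyFun = _
    rw [mulCLM_ofTrig, polyFun_ofTrig]
    rfl
  isTrigPoly_one := isTrigPoly_ofTrig _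
  polyFun_one := polyFun_ofTrig 1
  norm_mul_le := norm_mulCLM_le
  mul_comm := mulCLM_comm
  mul_assoc := mulCLM_assoc
  one_mul := ofTrig_one_mulCLM

lemma norm_single_comp_trigTranslate_le (s : G) (π : DualObject G) (f : trigSpace π) :
    ‖(single ω π).comp (trigTranslate s π) f‖ ≤ 1 * ‖single ω π f‖ := by
  rw [one_mul]
  exact norm_single_trigTranslate_le s π f

/-- Right translation on `A_ω(G)`. -/
def translate (s : G) : BeurlingFourier ω →L[ℂ] BeurlingFourier ω :=
  lift (fun π => (single ω π).comp (trigTranslate s π)) 1 (norm_single_comp_trigTranslate_le s)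

lemma translate_single (s : G) (π : DualObject G) (f : trigSpace π) :
    translate s (single ω π f) = single ω π (trigTranslate s π f) :=
  lift_single _ _ (norm_single_comp_trigTranslate_le s) _ _

lemma norm_translate_le (s : G) (u : BeurlingFourier ω) : ‖translate s u‖ ≤ ‖u‖ :=
  ((translate s).le_of_opNorm_le (norm_lift_le _ _ (norm_single_comp_trigTranslate_le s)
    zero_le_one) u).trans (one_mul _).le

lemma translate_ofTrig (s : G) (f : trigAlgebra G) :
    translate s (ofTrig ω f) =
      ofTrig ω ⟨rightTranslate s f, rightTranslate_mem_trigAlgebra s f.2⟩ := by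
  have h : (translate s).toLinearMap.comp (ofTrig ω) = (ofTrig ω).comp
      (((rightTranslate s).toLinearMap.restrict (p := Subalgebra.toSubmodule (trigAlgebra G))
        (q := Subalgebra.toSubmodule (trigAlgebra G))
        fun f hf => rightTranslate_mem_trigAlgebra s hf)) :=
    trigAlgebra_linearMap_ext fun π f => translate_single s π f
  exact LinearMap.congr_fun h f

end BeurlingFourier

/-! ### Uniqueness of the product. -/

namespace BeurlingFourierProduct

open BeurlingFourier

variable {ω : DualWeight G}

lemma mul_ofTrig (P : BeurlingFourierProduct ω) (f g : trigAlgebra G) :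
    P.mul (ofTrig ω f) (ofTrig ω g) = ofTrig ω (f * g) := by
  have hu := isTrigPoly_ofTrig (ω := ω) f
  have hv := isTrigPoly_ofTrig (ω := ω) g
  rw [(P.isTrigPoly_mul _ _ hu hv).eq_ofTrig]
  congr 1
  apply Subtype.ext
  change (P.mul (ofTrig ω f) (ofTrig ω g)).polyFun = _
  rw [P.polyFun_mul _ _ hu hv, polyFun_ofTrig, polyFun_ofTrig]
  rfl

lemma one_eq_ofTrig (P : BeurlingFourierProduct ω) : P.one = ofTrig ω 1 := by
  rw [P.isTrigPoly_one.eq_ofTrig]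
  congr 1
  exact Subtype.ext P.polyFun_one

/-- The product as a continuous bilinear map. -/
def toCLM (P : BeurlingFourierProduct ω) :
    BeurlingFourier ω →L[ℂ] BeurlingFourier ω →L[ℂ] BeurlingFourier ω :=
  P.mul.mkContinuous₂ 1 fun u v => by simpa using P.norm_mul_le u v

lemma toCLM_apply (P : BeurlingFourierProduct ω) (u v : BeurlingFourier ω) :
    P.toCLM u v = P.mul u v := rfl

/-- The product is determined by its values on trigonometric polynomials. -/
lemma eq_product (P : BeurlingFourierProduct ω) : P = product ω := by
  -- Submultiplicativity makes any such product continuous, so it is enough to compare on pairs of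
  -- components, where both are pointwise multiplication.
  have h : P.toCLM = mulCLM ω := clm_ext fun π f => clm_ext fun σ g => by
    rw [mulCLM_single, toCLM_apply]
    exact P.mul_ofTrig _ _
  refine BeurlingFourierProduct.ext ?_ P.one_eq_ofTrig
  exact LinearMap.ext₂ fun u v => DFunLike.congr_fun (DFunLike.congr_fun h u) v

end BeurlingFourierProduct

end BeurlingFourier

/-! ### Semisimplicity, by characters and translations. -/

/-- The radical of a commutative complex Banach algebra is the common kernel of the characters. -/
lemma mem_jacobson_iff_forall_algHom {A : Type*} [NormedCommRing A] [NormedAlgebra ℂ A]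
    [CompleteSpace A] {a : A} : a ∈ Ring.jacobson A ↔ ∀ φ : A →ₐ[ℂ] ℂ, φ a = 0 := by
  rw [Ring.jacobson_eq_sInf_isMaximal, Submodule.mem_sInf]
  constructor
  · intro h φ
    exact h _ (RingHom.ker_isMaximal_of_surjective (φ : A →+* ℂ) fun z =>
      ⟨algebraMap ℂ A z, by simp⟩)
  · intro h (I : Ideal A) hI
    have : I.IsMaximal := hI
    -- By Gelfand–Mazur every maximal ideal is the kernel of a character.
    let φ : A →ₐ[ℂ] ℂ := WeakDual.CharacterSpace.toAlgHom I.toCharacterSpace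
    have hle : I ≤ RingHom.ker (φ : A →+* ℂ) := fun x hx =>
      I.toCharacterSpace_apply_eq_zero_of_mem hx
    rw [this.eq_of_le (RingHom.ker_ne_top _) hle]
    exact h φ

section BeurlingFourier

variable {G : Type*} [Group G] [TopologicalSpace G] [IsTopologicalGroup G] [CompactSpace G]
  [MeasurableSpace G] [BorelSpace G]

/-- Allows Fourier coefficients to be taken term by term in a uniformly convergent series. -/
lemma continuous_fourierOp_apply (π : DualObject G) (i j : Fin π.rep.dim) :
    Continuous fun u : C(G, ℂ) => fourierOp π u i j := by
  let L : C(G, ℂ) →ₗ[ℂ] ℂ := LinearMap.proj j ∘ₗ LinearMap.proj i ∘ₗ fourierOp π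
  refine (L.mkContinuous ‖matrixCoeff π.rep i j‖ fun u => ?_).continuous
  change ‖∫ s, u s * π.rep.mat s⁻¹ i j ∂haarProb G‖ ≤ _
  refine (norm_integral_le_of_norm_le_const (C := ‖matrixCoeff π.rep i j‖ * ‖u‖)
    (Filter.Eventually.of_forall fun s => ?_)).trans (by simp)
  rw [norm_mul, mul_comm]
  exact mul_le_mul ((matrixCoeff π.rep i j).norm_coe_le_norm s⁻¹) (u.norm_coe_le_norm s)
    (norm_nonneg _) (norm_nonneg _)

/-- The components of a convergent trigonometric series with sum zero vanish. -/
lemma eq_zero_of_hasSum_zero {h : DualObject G → C(G, ℂ)} (hmem : ∀ π, h π ∈ trigSpace π)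
    (hsum : HasSum h 0) (π : DualObject G) : h π = 0 := by
  refine eq_zero_of_fourierOp_eq_zero (hmem π) ?_
  ext i j
  let L : C(G, ℂ) →ₗ[ℂ] ℂ := LinearMap.proj j ∘ₗ LinearMap.proj i ∘ₗ fourierOp π
  have h1 : HasSum (fun σ => L (h σ)) (L 0) := hsum.map L (continuous_fourierOp_apply π i j)
  rw [map_zero] at h1
  refine (hasSum_single π fun σ hne => ?_).unique h1
  change fourierOp π (h σ) i j = 0
  rw [fourierOp_of_mem_of_ne hne (hmem σ)]
  rfl

/-- The component of `u` at the trivial class is the mean of `u`. -/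
lemma isotypicPart_of_trivial {π : DualObject G} (h : ∀ s, π.rep.mat s = 1) (u : C(G, ℂ)) :
    (isotypicPart π u : C(G, ℂ)) =
      ((π.rep.dim : ℂ) * π.rep.dim * ∫ s, u s ∂haarProb G) • (1 : C(G, ℂ)) := by
  ext t
  have h1 : ∀ i j, fourierOp π u i j = if i = j then ∫ s, u s ∂haarProb G else 0 := fun i j => by
    change ∫ s, u s * π.rep.mat s⁻¹ i j ∂haarProb G = _
    simp only [h, Matrix.one_apply]
    split_ifs <;> simp
  simp [isotypicPart_eq, matrixCoeff_apply, h, h1, mul_assoc]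

lemma integral_mul_star_ne_zero {f : C(G, ℂ)} (hf : f ≠ 0) :
    ∫ s, (f * star f) s ∂haarProb G ≠ 0 := by
  obtain ⟨x, hx⟩ : ∃ x, f x ≠ 0 := by
    by_contra! hcon
    exact hf (ContinuousMap.ext hcon)
  have h1 : ∀ s, (f * star f) s = ((‖f s‖ ^ 2 : ℝ) : ℂ) := fun s => by
    simp [Complex.mul_conj, Complex.normSq_eq_norm_sq]
  simp_rw [h1]
  rw [integral_complex_ofReal, Complex.ofReal_ne_zero]
  have hc : Continuous fun s => ‖f s‖ ^ 2 := by fun_prop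
  exact (hc.integral_pos_of_hasCompactSupport_nonneg_nonzero (x := x)
    (HasCompactSupport.of_compactSpace _) (fun s => by positivity) (by simpa using hx)).ne'

namespace BeurlingFourier

variable {ω : DualWeight G}

lemma translate_one (u : BeurlingFourier ω) : translate 1 u = u := by
  have h : translate (ω := ω) (1 : G) = ContinuousLinearMap.id ℂ _ := clm_ext fun π f => by
    rw [translate_single, ContinuousLinearMap.id_apply]
    congr 1
    ext t
    exact congrArg (f : C(G, ℂ)) (mul_one t)
  rw [h, ContinuousLinearMap.id_apply]

/-- The function `s ↦ L(R_s f)` lies in `Trig_π(G)` for `f` in `Trig_π(G)`. -/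
lemma exists_mem_trigSpace_translate (L : BeurlingFourier ω →L[ℂ] ℂ) (π : DualObject G)
    (f : trigSpace π) : ∃ h ∈ trigSpace π, ∀ s, h s = L (translate s (single ω π f)) := by
  obtain ⟨M, hM⟩ : ∃ M : G → trigSpace π →ₗ[ℂ] ℂ,
      ∀ s f, M s f = L (translate s (single ω π f)) :=
    ⟨fun s => (L ∘L translate s).toLinearMap ∘ₗ single ω π, fun _ _ => rfl⟩
  simp only [← hM]
  obtain ⟨f, hf⟩ := f
  suffices ∃ hf : f ∈ trigSpace π, ∃ h ∈ trigSpace π, ∀ s, h s = M s ⟨f, hf⟩ from this.2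
  induction hf using Submodule.span_induction with
  | mem x hx =>
    obtain ⟨⟨k, l⟩, rfl⟩ := hx
    -- From π(ts)_{kl} = Σ_m π(t)_{km} π(s)_{ml}, applying L in the variable t leaves a combination
    -- of the coefficients π(s)_{ml}.
    refine ⟨matrixCoeff_mem π k l, ∑ m, L (single ω π ⟨_, matrixCoeff_mem π k m⟩) •
      matrixCoeff π.rep m l, Submodule.sum_mem _ fun m _ =>
        Submodule.smul_mem _ _ (matrixCoeff_mem π m l), fun s => ?_⟩
    have h1 : trigTranslate s π ⟨_, matrixCoeff_mem π k l⟩ =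
        ∑ m, π.rep.mat s m l • ⟨_, matrixCoeff_mem π k m⟩ := by
      ext t
      rw [AddSubmonoidClass.coe_finsetSum, ContinuousMap.sum_apply]
      change π.rep.mat (t * s) k l = _
      rw [UnitaryIrrep.mat_mul, Matrix.mul_apply]
      exact Finset.sum_congr rfl fun m _ => mul_comm _ _
    rw [hM, translate_single, h1, map_sum, map_sum, ContinuousMap.sum_apply]
    simp only [map_smul, ContinuousMap.smul_apply, matrixCoeff_apply, smul_eq_mul, mul_comm]
  | zero => exact ⟨Submodule.zero_mem _, 0, Submodule.zero_mem _, fun s => (map_zero (M s)).symm⟩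
  | add x y _ _ hx hy =>
    obtain ⟨hx, h, hh, h1⟩ := hx
    obtain ⟨hy, k, hk, k1⟩ := hy
    refine ⟨Submodule.add_mem _ hx hy, h + k, Submodule.add_mem _ hh hk, fun s => ?_⟩
    have h2 := (M s).map_add ⟨x, hx⟩ ⟨y, hy⟩
    rw [ContinuousMap.add_apply, h1 s, k1 s]
    exact h2.symm
  | smul c x _ hx =>
    obtain ⟨hx, h, hh, h1⟩ := hx
    refine ⟨Submodule.smul_mem _ c hx, c • h, Submodule.smul_mem _ c hh, fun s => ?_⟩
    have h2 := (M s).map_smul c ⟨x, hx⟩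
    rw [ContinuousMap.smul_apply, h1 s]
    exact h2.symm

/-- A continuous functional vanishing on all right translates of `u` vanishes on the components
of `u`. -/
lemma apply_single_eq_zero (L : BeurlingFourier ω →L[ℂ] ℂ) {u : BeurlingFourier ω}
    (hL : ∀ s, L (translate s u) = 0) (π : DualObject G) : L (single ω π (proj π u)) = 0 := by
  choose h hmem hh using fun π => exists_mem_trigSpace_translate L π (proj π u)
  have hbound : ∀ π, ‖h π‖ ≤ ‖L‖ * ‖single ω π (proj π u)‖ := fun π => by
    refine (ContinuousMap.norm_le _ (by positivity)).2 fun s => ?_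
    rw [hh]
    exact (L.le_opNorm _).trans
      (mul_le_mul_of_nonneg_left (norm_translate_le s _) (norm_nonneg _))
  -- The sup norm of h_π is controlled by the norm of u_π in A_ω(G), so the series converges
  -- uniformly on G even when that of u does not.
  have hs : Summable h := Summable.of_norm (Summable.of_nonneg_of_le (fun _ => norm_nonneg _) hbound
    ((summable_norm_single u).mul_left _))
  have hzero : ∑' π, h π = 0 := by
    ext s
    have h1 : HasSum (fun π => h π s) ((∑' π, h π) s) :=
      hs.hasSum.mapL (ContinuousMap.evalCLM ℂ s)
    have h2 : HasSum (fun π => h π s) (L (translate s u)) := by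
      simp only [hh]
      exact (hasSum_single u).mapL (L ∘L translate s)
    rw [h1.unique h2, hL]
    rfl
  have := hs.hasSum
  rw [hzero] at this
  -- Every h_π vanishes identically; its value at the identity is L(u_π).
  have h1 := hh π 1
  rw [eq_zero_of_hasSum_zero hmem this π, translate_one] at h1
  exact h1.symm

end BeurlingFourier

namespace BeurlingFourierProduct

open BeurlingFourier

variable {ω : DualWeight G} (P : BeurlingFourierProduct ω)

instance : CompleteSpace P.Alg := inferInstanceAs (CompleteSpace (BeurlingFourier ω))

/-- Elements are formal series without point values, so the identity is checked on trigonometric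
polynomials and extended by continuity in each factor. -/
lemma translate_mul (s : G) (u v : BeurlingFourier ω) :
    translate s (P.mul u v) = P.mul (translate s u) (translate s v) := by
  have h1 : ∀ π f, translate s ∘L P.toCLM (single ω π f) =
      P.toCLM (translate s (single ω π f)) ∘L translate s := fun π f => clm_ext fun σ g => by
    change translate s (P.mul (ofTrig ω _) (ofTrig ω _)) =
      P.mul (translate s (ofTrig ω _)) (translate s (ofTrig ω _))
    rw [mul_ofTrig, translate_ofTrig, translate_ofTrig, translate_ofTrig, mul_ofTrig]
    congr 1
  have h2 : translate s ∘L P.toCLM.flip v = P.toCLM.flip (translate s v) ∘L translate s :=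
    clm_ext fun π f => DFunLike.congr_fun (h1 π f) v
  exact DFunLike.congr_fun h2 u

/-- Right translation as an endomorphism of the Beurling–Fourier algebra. -/
def translateAlgHom (s : G) : P.Alg →ₐ[ℂ] P.Alg :=
  AlgHom.ofLinearMap (A := P.Alg) (B := P.Alg) (translate (ω := ω) s).toLinearMap (by
    change translate s P.one = P.one
    rw [one_eq_ofTrig, translate_ofTrig]
    congr 1) (P.translate_mul s)

/-- The identity map from `A_ω(G)` to the Beurling–Fourier algebra. -/
def toAlg : BeurlingFourier ω →ₗ[ℂ] P.Alg := LinearMap.id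

lemma toAlg_mul (u v : BeurlingFourier ω) : P.toAlg (P.mul u v) = P.toAlg u * P.toAlg v := rfl

lemma toAlg_one : P.toAlg P.one = 1 := rfl

/-- The radical contains the components of its elements. -/
lemma single_mem_jacobson {u : BeurlingFourier ω} (hu : P.toAlg u ∈ Ring.jacobson P.Alg)
    (π : DualObject G) : P.toAlg (single ω π (proj π u)) ∈ Ring.jacobson P.Alg := by
  rw [mem_jacobson_iff_forall_algHom] at hu ⊢
  intro φ
  -- Characters of a Banach algebra are continuous, and φ ∘ R_s is a character, so it kills u.
  exact apply_single_eq_zero φ.toContinuousLinearMap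
    (fun s => hu (φ.comp (P.translateAlgHom s))) π

/-- The Beurling–Fourier algebra is semisimple. -/
theorem jacobson_eq_bot : Ring.jacobson P.Alg = ⊥ := by
  refine (Submodule.eq_bot_iff _).2 fun a ha => ?_
  obtain ⟨u, rfl⟩ : ∃ u, P.toAlg u = a := ⟨a, rfl⟩
  by_contra hne
  obtain ⟨π, hπ⟩ : ∃ π, proj π u ≠ 0 := by
    by_contra! hcon
    exact hne (by rw [show u = 0 from ext_component hcon, map_zero])
  have : Nontrivial P.Alg := ⟨P.toAlg u, 0, hne⟩
  obtain ⟨τ, hτ⟩ := exists_trivial_class G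
  set f := proj π u
  have hf : (f : C(G, ℂ)) ≠ 0 := fun h => hπ (Subtype.ext h)
  let g : trigAlgebra G := ⟨star (f : C(G, ℂ)), star_mem_trigPoly (trigInclusion π f).2⟩
  have h1 : P.toAlg (ofTrig ω (trigInclusion π f * g)) ∈ Ring.jacobson P.Alg := by
    rw [← P.mul_ofTrig, toAlg_mul]
    exact Ideal.mul_mem_right _ _ (P.single_mem_jacobson ha π)
  -- The component of f f̄ at the trivial class is again in the radical.
  have h2 := P.single_mem_jacobson h1 τ
  rw [ofTrig_apply] at h2
  have hd : (τ.rep.dim : ℂ) ≠ 0 := Nat.cast_ne_zero.2 τ.rep.dim_pos.ne'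
  -- One factor `τ.rep.dim` comes from the inversion formula, the other from the trace of the
  -- identity matrix.
  set c : ℂ := (τ.rep.dim : ℂ) * τ.rep.dim * ∫ s, ((f : C(G, ℂ)) * star (f : C(G, ℂ))) s ∂haarProb G
  have hc : c ≠ 0 := mul_ne_zero (mul_ne_zero hd hd) (integral_mul_star_ne_zero hf)
  have h3 : single ω τ (isotypicPart τ (trigInclusion π f * g : trigAlgebra G).1) = c • P.one := by
    rw [one_eq_ofTrig, ← map_smul]
    exact congrArg (ofTrig ω) (Subtype.ext (isotypicPart_of_trivial hτ
      ((f : C(G, ℂ)) * star (f : C(G, ℂ)))))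
  rw [h3] at h2
  rw [map_smul, toAlg_one] at h2
  have h4 := Submodule.smul_of_tower_mem (Ring.jacobson P.Alg) c⁻¹ h2
  rw [inv_smul_smul₀ hc] at h4
  exact (Ring.jacobson_lt_top (R := P.Alg)).ne ((Ideal.eq_top_iff_one _).2 h4)

end BeurlingFourierProduct

end BeurlingFourier

end

theorem mainTheorem8 {G : Type*} [Group G] [TopologicalSpace G] [IsTopologicalGroup G]
    [CompactSpace G] [T2Space G] [MeasurableSpace G] [BorelSpace G] (ω : DualWeight G) :
    CompleteSpace (BeurlingFourier ω) ∧
      ∃ P : BeurlingFourierProduct ω, (∀ Q : BeurlingFourierProduct ω, Q = P) ∧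
        Ring.jacobson P.Alg = ⊥ :=
  ⟨inferInstance, BeurlingFourier.product ω, fun Q => Q.eq_product,
    (BeurlingFourier.product ω).jacobson_eq_bot⟩
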